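/- Let $U$ be an optimal prefix machine: a partial computable function $U(p,y)$ of binary strings $p$ (program) and $y$ (side input) such that for every $y$ the set $\{p: U(p,y)\downarrow\}$ is prefix-free, and such that for every other such function $V$ there is a constant $c_V$ for which $V(p,y)=x$ implies $U(q,y)=x$ for some $q$ of length $\ell(q)\le \ell(p)+c_V$. Let $K(x|y):=\min\{\ell(p):U(p,y)=x\}$ and $K(x):=K(x|\epsilon)$, where $\epsilon$ is the empty string; finite tuples of strings and finite families of finite sets of integers are encoded as binary strings in a fixed computable and injective way (the empty tuple as $\epsilon$). Logarithms are to base $2$. **Theorem (General randomization).** For every $m$ there is a constant $c$, depending only on $U$ and $m$, such that the following holds. Let $x_1,\dots,x_m\in\{0,1\}^*$, let $M=\{1,\dots,m\}$, write $x_I:=(x_i)_{i\in I}$ for $I\subseteq M$, let $\mathcal I\subseteq 2^M$ be a family of index sets with $M\in\mathcal I$, and let $s:=K(x_M)$. Then there are a probability space $(\Omega,P)$ and random variables $Z_1,\dots,Z_m:\Omega\to\{0,1\}^*$ such that, simultaneously for all $I,J\subseteq M$ with $I\cup J\in\mathcal I$ and $J\in\mathcal I$, and for all $\omega\in\Omega$,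 the value at $\omega$ of $P[Z_I|Z_J]$, i.e. $P[Z_I=Z_I(\omega)\mid Z_J=Z_J(\omega)]$, is well defined and positive, and $$\bigl|\log P[Z_I|Z_J]+K(x_I|x_J)\bigr|\;\le\; B+c,\qquad B:=(2.2\,|\mathcal I|+5.5)\log s+2.2\,K(\mathcal I).$$ In particular $P[Z_I|Z_J]$ is approximately uniform: its logarithms at any two outcomes $\omega,\omega'\in\Omega$ differ by at most $2(B+c)$. If $J=\emptyset\in\mathcal I$, the conditions can be dropped: $P[Z_I]>0$ and $|\log P[Z_I]+K(x_I)|\le B+c$ for all $I\in\mathcal I$ and all $\omega\in\Omega$. -/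

import Mathlib

open MeasureTheory

namespace AlgInfo

/-- A (conditional) prefix machine: a partial computable function `V p y` of a binary program `p`
and a binary side input `y`, whose halting programs form a prefix-free set for every fixed `y`. -/
structure IsPrefixMachine (V : List Bool → List Bool →. List Bool) : Prop where
  partrec : Partrec₂ V
  prefix_free : ∀ y p q : List Bool, (V p y).Dom → (V q y).Dom → p <+: q → p = q

/-- An optimal prefix machine: it is a prefix machine, and it simulates every prefix machine `V`
with programs that are longer by at most an additive constant depending on `V` only. -/
structure IsOptimalPrefixMachine (U : List Bool → List Bool →. List Bool) : Prop
    extends IsPrefixMachine U where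
  optimal : ∀ V : List Bool → List Bool →. List Bool, IsPrefixMachine V →
    ∃ c : ℕ, ∀ p y x : List Bool, x ∈ V p y →
      ∃ q : List Bool, x ∈ U q y ∧ q.length ≤ p.length + c

/-- Conditional prefix Kolmogorov complexity `K(x|y) = min {ℓ(p) : U(p,y) = x}`.
(For an optimal `U` the set is never empty.) -/
noncomputable def condK (U : List Bool → List Bool →. List Bool) (x y : List Bool) : ℕ :=
  sInf {n : ℕ | ∃ p : List Bool, p.length = n ∧ x ∈ U p y}

/-- Prefix Kolmogorov complexity `K(x)`, with empty side input. -/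
noncomputable def K (U : List Bool → List Bool →. List Bool) (x : List Bool) : ℕ :=
  condK U x []

/-- Self-delimiting code of a string: every bit is preceded by a `1`, and a `0` ends the string. -/
def selfDelim (w : List Bool) : List Bool :=
  w.flatMap (fun b => [true, b]) ++ [false]

/-- Binary code of a finite tuple of strings. -/
def encodeTuple (l : List (List Bool)) : List Bool :=
  l.flatMap selfDelim

/-- The sub-collection `x_I = (x_i)_{i ∈ I}`, in increasing order of `i`, as a binary string. -/
def sub {m : ℕ} (x : Fin m → List Bool) (I : Finset (Fin m)) : List Bool :=
  encodeTuple (((List.finRange m).filter (fun i => decide (i ∈ I))).map x)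

/-- Binary code of a family of subsets of `Fin m`: the characteristic string of length `2 ^ m`
whose `k`-th bit tells whether the subset `{i | the i-th binary digit of k is 1}` is a member. -/
def encodeFamily {m : ℕ} (F : Finset (Finset (Fin m))) : List Bool :=
  List.ofFn (fun k : Fin (2 ^ m) =>
    decide (Finset.univ.filter (fun i : Fin m => (k : ℕ).testBit (i : ℕ) = true) ∈ F))

/-- The event that the random tuple `Z_I` takes the value that it takes at the outcome `ω`. -/
def sameOutcome {Ω : Type*} {m : ℕ} (Z : Fin m → Ω → List Bool) (I : Finset (Fin m)) (ω : Ω) :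
    Set Ω :=
  {ω' | ∀ i ∈ I, Z i ω' = Z i ω}

/-- The random variable `P[Z_I]`: its value at `ω` is the probability that `Z_I = Z_I(ω)`. -/
noncomputable def prob {Ω : Type*} [MeasurableSpace Ω] {m : ℕ} (P : Measure Ω)
    (Z : Fin m → Ω → List Bool) (I : Finset (Fin m)) (ω : Ω) : ℝ :=
  (P (sameOutcome Z I ω)).toReal

/-- The random variable `P[Z_I|Z_J]`: its value at `ω` is the conditional probability that
`Z_I = Z_I(ω)` given that `Z_J = Z_J(ω)`. -/
noncomputable def condProb {Ω : Type*} [MeasurableSpace Ω] {m : ℕ} (P : Measure Ω)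
    (Z : Fin m → Ω → List Bool) (I J : Finset (Fin m)) (ω : Ω) : ℝ :=
  (ProbabilityTheory.cond P (sameOutcome Z J ω) (sameOutcome Z I ω)).toReal

/-- The error bound `(2.2 |F| + 5.5) log₂ s + 2.2 K(F)` with `s = K(x_M)`, `M` the full index set. -/
noncomputable def errorBound (U : List Bool → List Bool →. List Bool) {m : ℕ}
    (x : Fin m → List Bool) (F : Finset (Finset (Fin m))) : ℝ :=
  (2.2 * (F.card : ℝ) + 5.5) * Real.logb 2 (K U (sub x Finset.univ) : ℝ)
    + 2.2 * (K U (encodeFamily F) : ℝ)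

end AlgInfo

/-! Fix the family F and write k_J = K(x_J), s = k_M. The random tuple is drawn uniformly from a
finite set of tuples in which the number of z with prescribed z_J is about 2^(s - k_J) for every J
in F. Under the uniform law P[Z_I|Z_J] is the quotient of the fibre sizes for I ∪ J and for J, hence
about 2^(k_J - k_{I∪J}), and symmetry of information identifies k_{I∪J} - k_J with K(x_I|x_J) up to
logarithmic terms. Every point of the sample space has positive mass, so the estimate holds at all
outcomes.

The set comes from `profileClass`: all z with K(z_J) ≤ k_J and K(z_M|z_J) ≤ s - k_J + O(log s) for J
in F. Symmetry of information (`exists_condK_sub_add_le`) puts x in it. The second condition bounds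
all fibres from above. The class can be enumerated from the numbers k_J, so x is described by these
numbers and its rank in the enumeration; hence the class has at least about 2^(s - (|F|+1) log s)
elements (`exists_K_sub_le_of_mem_profileClass`).

Some fibres may be too small. Since z_J takes at most 2^(k_J) values, fibres much smaller than the
average account for only part of the class, and an extremal argument (`exists_subset_large_fibers`)
passes to a nonempty subset where all fibres are large. The result is
`exists_finset_regular_fibers`.

All upper bounds on complexity come from one tool, the Kraft-Chaitin theorem in the form
`exists_condK_le`: a semidecidable family of requests of bounded total weight can be answered by
programs of the requested lengths up to a constant. -/

namespace AlgInfo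

open scoped ENNReal

/-! ### Semidecidable predicates -/

/-- Semidecidability, witnessed by a primitive recursive stage predicate. -/
def SemiDecidable {α : Type*} [Primcodable α] (p : α → Prop) : Prop :=
  ∃ g : α → ℕ → Prop, PrimrecRel g ∧ ∀ a, p a ↔ ∃ t, g a t

section SemiDecidable

variable {α β ι : Type*} [Primcodable α] [Primcodable β]

theorem primrecPred_exists_mem_option {o : α → Option β} {q : α → β → Prop}
    (ho : Primrec o) (hq : PrimrecRel q) : PrimrecPred fun a => ∃ b ∈ o a, q a b := by
  classical
  refine Primrec.primrecPred ?_
  refine (Primrec.option_casesOn ho (Primrec.const false)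
    (g := fun a b => decide (q a b)) hq.decide).of_eq fun a => ?_
  cases h : o a <;> simp

theorem primrecPred_const {p : Prop} : PrimrecPred (fun _ : α => p) := by
  classical
  exact Primrec.primrecPred (Primrec.const _)

namespace SemiDecidable

theorem of_eq {p q : α → Prop} (hp : SemiDecidable p) (h : ∀ a, p a ↔ q a) :
    SemiDecidable q := by
  obtain ⟨g, hg, hpg⟩ := hp
  exact ⟨g, hg, fun a => (h a).symm.trans (hpg a)⟩

theorem of_primrecPred {p : α → Prop} (hp : PrimrecPred p) : SemiDecidable p :=
  ⟨fun a _ => p a, PrimrecPred.comp hp Primrec.fst, fun a => by simp⟩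

theorem comp {p : β → Prop} (hp : SemiDecidable p) {f : α → β} (hf : Primrec f) :
    SemiDecidable fun a => p (f a) := by
  obtain ⟨g, hg, hpg⟩ := hp
  exact ⟨fun a t => g (f a) t, PrimrecRel.comp hg (hf.comp Primrec.fst) Primrec.snd,
    fun a => hpg _⟩

theorem and {p q : α → Prop} (hp : SemiDecidable p) (hq : SemiDecidable q) :
    SemiDecidable fun a => p a ∧ q a := by
  obtain ⟨g, hg, hpg⟩ := hp
  obtain ⟨g', hg', hpg'⟩ := hq
  refine ⟨fun a t => g a t.unpair.1 ∧ g' a t.unpair.2, ?_, fun a => ?_⟩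
  · exact PrimrecPred.and
      (PrimrecRel.comp hg Primrec.fst (Primrec.fst.comp (Primrec.unpair.comp Primrec.snd)))
      (PrimrecRel.comp hg' Primrec.fst (Primrec.snd.comp (Primrec.unpair.comp Primrec.snd)))
  · change (p a ∧ q a) ↔ _
    rw [hpg, hpg']
    constructor
    · rintro ⟨⟨t, ht⟩, t', ht'⟩
      exact ⟨Nat.pair t t', by simpa using ⟨ht, ht'⟩⟩
    · rintro ⟨t, h, h'⟩
      exact ⟨⟨_, h⟩, _, h'⟩

theorem exists_of {p : α → β → Prop} (hp : SemiDecidable fun a : α × β => p a.1 a.2) :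
    SemiDecidable fun a => ∃ b, p a b := by
  obtain ⟨g, hg, hpg⟩ := hp
  refine ⟨fun a t => ∃ b ∈ (Encodable.decode t.unpair.1 : Option β), g (a, b) t.unpair.2,
    ?_, fun a => ?_⟩
  · exact primrecPred_exists_mem_option
      (o := fun a : α × ℕ => (Encodable.decode a.2.unpair.1 : Option β))
      (q := fun a b => g (a.1, b) a.2.unpair.2)
      (Primrec.decode.comp (Primrec.fst.comp (Primrec.unpair.comp Primrec.snd)))
      (PrimrecRel.comp hg
        (Primrec.pair (Primrec.fst.comp Primrec.fst) Primrec.snd)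
        (Primrec.snd.comp (Primrec.unpair.comp (Primrec.snd.comp Primrec.fst))))
  · constructor
    · rintro ⟨b, hb⟩
      obtain ⟨t, ht⟩ := (hpg (a, b)).1 hb
      exact ⟨Nat.pair (Encodable.encode b) t, b, by simp, by simpa using ht⟩
    · rintro ⟨t, b, -, hb⟩
      exact ⟨b, (hpg (a, b)).2 ⟨_, hb⟩⟩

theorem forall_mem_list {p : α → β → Prop} (hp : SemiDecidable fun a : α × β => p a.1 a.2) :
    SemiDecidable fun a : α × List β => ∀ b ∈ a.2, p a.1 b := by
  obtain ⟨g, hg, hpg⟩ := hp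
  refine ⟨fun a T => ∀ b ∈ a.2, ∃ t < T, g (a.1, b) t, ?_, fun a => ?_⟩
  · have h1 : PrimrecRel fun (b : β) (y : α × ℕ) => ∃ t < y.2, g (y.1, b) t := by
      have h2 : PrimrecRel fun (t : ℕ) (z : α × β) => g z t := hg.swap
      have h3 : PrimrecRel fun (n : ℕ) (z : α × β) => ∃ t < n, g z t :=
        (PrimrecRel.comp h2.exists_mem_list (Primrec.list_range.comp Primrec.fst)
          Primrec.snd).of_eq fun z => by simp
      exact PrimrecRel.comp h3 (Primrec.snd.comp Primrec.snd)
        (Primrec.pair (Primrec.fst.comp Primrec.snd) Primrec.fst)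
    exact PrimrecRel.comp h1.forall_mem_list (Primrec.snd.comp Primrec.fst)
      (Primrec.pair (Primrec.fst.comp Primrec.fst) Primrec.snd)
  · obtain ⟨a, l⟩ := a
    constructor
    · intro h
      have h' : ∀ b, ∃ t, b ∈ l → g (a, b) t := fun b => by
        by_cases hb : b ∈ l
        · obtain ⟨t, ht⟩ := (hpg (a, b)).1 (h b hb)
          exact ⟨t, fun _ => ht⟩
        · exact ⟨0, fun hb' => absurd hb' hb⟩
      choose τ hτ using h'
      -- The sum of the individual stages is a common bound for all of them.
      refine ⟨(l.map τ).sum + 1, fun b hb => ⟨τ b, ?_, hτ b hb⟩⟩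
      exact Nat.lt_succ_of_le (List.le_sum_of_mem (List.mem_map_of_mem hb))
    · rintro ⟨T, h⟩ b hb
      obtain ⟨t, -, ht⟩ := h b hb
      exact (hpg (a, b)).2 ⟨t, ht⟩

theorem forall_mem_finset (s : Finset ι) {p : ι → α → Prop}
    (hp : ∀ i ∈ s, SemiDecidable (p i)) : SemiDecidable fun a => ∀ i ∈ s, p i a := by
  classical
  induction s using Finset.induction_on with
  | empty => exact (of_primrecPred (primrecPred_const (p := True))).of_eq (by simp)
  | insert i s hi ih =>
    refine ((hp i (by simp)).and (ih fun j hj => hp j (by simp [hj]))).of_eq fun a => ?_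
    simp

end SemiDecidable

theorem primrecPred_nodup : PrimrecPred (fun l : List β => l.Nodup) := by
  classical
  refine Primrec.primrecPred ?_
  have hmem : PrimrecRel fun (b : β) (l : List β) => b ∈ l := by
    have h : PrimrecRel fun (l : List β) (b : β) => ∃ a ∈ l, a = b :=
      PrimrecRel.exists_mem_list Primrec.eq
    exact h.swap.of_eq fun b l => by simp
  refine (Primrec.list_rec (f := fun l : List β => l) (g := fun _ => true)
    (h := fun _ q => (!decide (q.1 ∈ q.2.1)) && q.2.2) Primrec.id (Primrec.const _) ?_).of_eq
    fun l => ?_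
  · refine Primrec.and.comp (Primrec.not.comp ?_) (Primrec.snd.comp (Primrec.snd.comp Primrec.snd))
    exact PrimrecPred.decide (PrimrecRel.comp (R := fun (b : β) (l : List β) => b ∈ l) hmem
      (Primrec.fst.comp Primrec.snd)
      (Primrec.fst.comp (Primrec.snd.comp Primrec.snd)))
  · induction l with
    | nil => simp
    | cons b l ih => simp only [List.nodup_cons, Bool.decide_and, ← ih, decide_not]

theorem SemiDecidable.exists_nodup_list {p : α → β → Prop}
    (hp : SemiDecidable fun a : α × β => p a.1 a.2) :
    SemiDecidable fun a : α × ℕ =>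
      ∃ l : List β, l.Nodup ∧ l.length = a.2 ∧ ∀ b ∈ l, p a.1 b := by
  refine SemiDecidable.exists_of (.and (.of_primrecPred ?_) (.and (.of_primrecPred ?_) ?_))
  · exact PrimrecPred.comp primrecPred_nodup Primrec.snd
  · exact PrimrecRel.comp Primrec.eq (Primrec.list_length.comp Primrec.snd)
      (Primrec.snd.comp Primrec.fst)
  · exact hp.forall_mem_list.comp
      (Primrec.pair (Primrec.fst.comp Primrec.fst) Primrec.snd)

end SemiDecidable

/-! ### The Kraft-Chaitin theorem -/

/-- The value of a binary string, most significant bit first. -/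
def binVal (p : List Bool) : ℕ :=
  p.foldl (fun n b => 2 * n + b.toNat) 0

theorem binVal_append (p q : List Bool) :
    binVal (p ++ q) = binVal p * 2 ^ q.length + binVal q := by
  induction q using List.reverseRecOn with
  | nil => simp [binVal]
  | append_singleton q b ih =>
    have h : ∀ l : List Bool, binVal (l ++ [b]) = 2 * binVal l + b.toNat := fun l => by
      simp [binVal]
    rw [← List.append_assoc, h, h, ih]
    simp only [List.length_append, List.length_singleton, pow_succ]
    ring

theorem binVal_lt (p : List Bool) : binVal p < 2 ^ p.length := by
  induction p using List.reverseRecOn with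
  | nil => simp [binVal]
  | append_singleton p b ih =>
    rw [binVal_append]
    have : binVal [b] < 2 := by cases b <;> simp [binVal]
    simp only [List.length_append, List.length_singleton, pow_succ]
    omega

theorem exists_binVal_eq (l : ℕ) : ∀ n < 2 ^ l, ∃ p : List Bool, p.length = l ∧ binVal p = n := by
  induction l with
  | zero => intro n hn; exact ⟨[], rfl, by simp [binVal] at *; omega⟩
  | succ l ih =>
    intro n hn
    obtain ⟨p, hp, hpn⟩ := ih (n / 2) (by rw [pow_succ] at hn; omega)
    refine ⟨p ++ [decide (n % 2 = 1)], by simp [hp], ?_⟩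
    rw [binVal_append, hpn]
    rcases Nat.mod_two_eq_zero_or_one n with h | h <;> simp [binVal, h] <;> omega

theorem primrec_binVal : Primrec binVal := by
  refine Primrec.list_foldl (f := fun p : List Bool => p) (g := fun _ => 0)
    (h := fun _ q => 2 * q.1 + q.2.toNat) Primrec.id (Primrec.const 0) ?_
  refine Primrec.nat_add.comp (Primrec.nat_mul.comp (Primrec.const 2)
    (Primrec.fst.comp Primrec.snd)) ?_
  exact (Primrec.dom_bool Bool.toNat).comp (Primrec.snd.comp Primrec.snd)

theorem primrec₂_pow : Primrec₂ ((· ^ ·) : ℕ → ℕ → ℕ) :=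
  Primrec₂.unpaired'.1 Nat.Primrec.pow

section KraftMachine

/-- The partial sums of the weights `2 ^ (-r)` of a list of requests `(r, x)`, as a fraction with
numerator `.1` and denominator `2 ^ .2`. -/
def kraftAcc (it : ℕ → Option (ℕ × List Bool)) (i : ℕ) : ℕ × ℕ :=
  Nat.rec (0, 0) (fun j a => (it j).elim a fun q => (a.1 * 2 ^ q.1 + 2 ^ a.2, a.2 + q.1)) i

/-- The weight of a request. -/
noncomputable def requestWeight (o : Option (ℕ × List Bool)) : ℝ :=
  o.elim 0 fun q => (1 / 2) ^ q.1

theorem requestWeight_nonneg (o : Option (ℕ × List Bool)) : 0 ≤ requestWeight o := by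
  cases o <;> simp [requestWeight]

theorem kraftAcc_eq_sum (it : ℕ → Option (ℕ × List Bool)) (i : ℕ) :
    ((kraftAcc it i).1 : ℝ) / 2 ^ (kraftAcc it i).2
      = ∑ j ∈ Finset.range i, requestWeight (it j) := by
  induction i with
  | zero => simp [kraftAcc]
  | succ i ih =>
    rw [Finset.sum_range_succ, ← ih]
    have h : kraftAcc it (i + 1) = (it i).elim (kraftAcc it i) fun q =>
      ((kraftAcc it i).1 * 2 ^ q.1 + 2 ^ (kraftAcc it i).2, (kraftAcc it i).2 + q.1) := rfl
    rw [h]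
    cases it i with
    | none => simp [requestWeight]
    | some q =>
      simp only [Option.elim, requestWeight]
      push_cast
      rw [pow_add, one_div, inv_pow]
      field_simp

/-- Program `p` answers the `i`-th request, if its dyadic interval is in the `i`-th interval of the
Shannon-Fano-Elias code of the list of requests, and it has the right length. -/
def kraftCheck (it : ℕ → Option (ℕ × List Bool)) (p : List Bool) (i : ℕ) : Option (List Bool) :=
  (it i).bind fun q =>
    if p.length = q.1 + 1 ∧
      (kraftAcc it i).1 * 2 ^ p.length ≤ binVal p * 2 ^ (kraftAcc it i).2 ∧
      (binVal p + 1) * 2 ^ (kraftAcc it i).2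
        ≤ (kraftAcc it i).1 * 2 ^ p.length + 2 * 2 ^ (kraftAcc it i).2
    then some q.2 else none

theorem mem_kraftCheck {it : ℕ → Option (ℕ × List Bool)} {p : List Bool} {i : ℕ}
    {x : List Bool} : x ∈ kraftCheck it p i ↔ ∃ r, it i = some (r, x) ∧ p.length = r + 1 ∧
      ∑ j ∈ Finset.range i, requestWeight (it j) ≤ binVal p / 2 ^ p.length ∧
      ((binVal p : ℝ) + 1) / 2 ^ p.length ≤ ∑ j ∈ Finset.range (i + 1), requestWeight (it j) := by
  rw [Finset.sum_range_succ, ← kraftAcc_eq_sum, kraftCheck]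
  rcases h : it i with _ | ⟨r, x'⟩
  · simp
  · simp only [Option.bind_some, Option.mem_def, Option.ite_none_right_eq_some, Option.some.injEq,
      Prod.mk.injEq]
    generalize kraftAcc it i = a
    have key : p.length = r + 1 →
        ((a.1 * 2 ^ p.length ≤ binVal p * 2 ^ a.2 ∧
          (binVal p + 1) * 2 ^ a.2 ≤ a.1 * 2 ^ p.length + 2 * 2 ^ a.2) ↔
        ((a.1 : ℝ) / 2 ^ a.2 ≤ binVal p / 2 ^ p.length ∧
      ((binVal p : ℝ) + 1) / 2 ^ p.length ≤ (a.1 : ℝ) / 2 ^ a.2 + requestWeight (some (r, x')))) := by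
      intro hp
      have h2 : requestWeight (some (r, x')) = 2 / 2 ^ p.length := by
        simp only [requestWeight, Option.elim, hp]
        rw [pow_succ]
        simp [div_eq_mul_inv]
      rw [h2, div_add_div _ _ (by positivity) (by positivity),
        div_le_div_iff₀ (by positivity) (by positivity),
        div_le_div_iff₀ (by positivity) (by positivity)]
      refine and_congr ?_ ?_
      · rw [← Nat.cast_le (α := ℝ)]; push_cast; rfl
      · rw [← Nat.cast_le (α := ℝ)]; push_cast
        have : (0 : ℝ) < 2 ^ p.length := by positivity
        rw [← mul_le_mul_iff_of_pos_right this]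
        constructor <;> intro h <;> nlinarith
    constructor
    · rintro ⟨⟨hp, hh⟩, rfl⟩
      exact ⟨r, ⟨rfl, rfl⟩, hp, (key hp).1 hh⟩
    · rintro ⟨r', ⟨rfl, rfl⟩, hp, hh⟩
      exact ⟨⟨hp, (key hp).2 hh⟩, rfl⟩

/-- If p is a prefix of q, then the dyadic interval of q lies inside that of p. Each is contained in
the interval of its own request, and intervals of distinct requests do not overlap, so the requests
agree. Then the lengths agree too. -/
theorem eq_of_mem_kraftCheck {it : ℕ → Option (ℕ × List Bool)} {p q : List Bool} {i j : ℕ}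
    {x x' : List Bool} (hp : x ∈ kraftCheck it p i) (hq : x' ∈ kraftCheck it q j)
    (hpq : p <+: q) : p = q ∧ i = j := by
  obtain ⟨r, hr, hlp, hp1, hp2⟩ := mem_kraftCheck.1 hp
  obtain ⟨r', hr', hlq, hq1, hq2⟩ := mem_kraftCheck.1 hq
  have mono : ∀ {a b : ℕ}, a ≤ b → ∑ k ∈ Finset.range a, requestWeight (it k)
      ≤ ∑ k ∈ Finset.range b, requestWeight (it k) := fun h =>
    Finset.sum_le_sum_of_subset_of_nonneg (Finset.range_mono h)
      fun k _ _ => requestWeight_nonneg _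
  obtain ⟨u, rfl⟩ := hpq
  have hu : (binVal u : ℝ) + 1 ≤ 2 ^ u.length := by exact_mod_cast binVal_lt u
  have h1 : (binVal p : ℝ) / 2 ^ p.length ≤ binVal (p ++ u) / 2 ^ (p ++ u).length := by
    rw [binVal_append, List.length_append, pow_add, div_le_div_iff₀ (by positivity) (by positivity)]
    push_cast
    nlinarith [show (0 : ℝ) ≤ binVal u * 2 ^ p.length by positivity]
  have h2 : ((binVal (p ++ u) : ℝ) + 1) / 2 ^ (p ++ u).length
      ≤ ((binVal p : ℝ) + 1) / 2 ^ p.length := by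
    rw [binVal_append, List.length_append, pow_add, div_le_div_iff₀ (by positivity) (by positivity)]
    push_cast
    nlinarith [show (0 : ℝ) < 2 ^ p.length by positivity]
  have h3 : ∀ w : List Bool, (binVal w : ℝ) / 2 ^ w.length < ((binVal w : ℝ) + 1) / 2 ^ w.length :=
    fun w => by gcongr; linarith
  have hij : i = j := by
    rcases lt_trichotomy i j with h | h | h
    · linarith [mono (Nat.succ_le_of_lt h), h3 (p ++ u)]
    · exact h
    · linarith [mono (Nat.succ_le_of_lt h), h3 (p ++ u), h3 p]
  subst hij
  rw [hr] at hr'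
  simp only [Option.some.injEq, Prod.mk.injEq] at hr'
  have : u.length = 0 := by
    rw [List.length_append] at hlq
    omega
  rw [List.length_eq_zero_iff] at this
  simp [this]

/-- An interval of length 2^(-r) need not be dyadic, but it contains a dyadic interval of half its
length. This is why programs are one bit longer than requested. -/
theorem exists_mem_kraftCheck {it : ℕ → Option (ℕ × List Bool)}
    (hsum : ∀ n, ∑ j ∈ Finset.range n, requestWeight (it j) ≤ 1) {i r : ℕ} {x : List Bool}
    (hi : it i = some (r, x)) : ∃ p : List Bool, p.length = r + 1 ∧ x ∈ kraftCheck it p i := by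
  set a := ∑ j ∈ Finset.range i, requestWeight (it j) with ha
  have ha0 : 0 ≤ a := Finset.sum_nonneg fun k _ => requestWeight_nonneg _
  have ha1 : ∑ j ∈ Finset.range (i + 1), requestWeight (it j) = a + 2 / 2 ^ (r + 1) := by
    rw [Finset.sum_range_succ, hi, ← ha]
    simp [requestWeight, pow_succ, div_eq_mul_inv]
  have h1 := hsum (i + 1)
  rw [ha1] at h1
  have hpos : (0 : ℝ) < 2 ^ (r + 1) := by positivity
  have h2 : a * 2 ^ (r + 1) + 2 ≤ 2 ^ (r + 1) := by
    have := mul_le_mul_of_nonneg_right h1 hpos.le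
    rwa [add_mul, div_mul_cancel₀ _ hpos.ne', one_mul] at this
  have hc := Nat.ceil_lt_add_one (mul_nonneg ha0 hpos.le)
  have hc' := Nat.le_ceil (a * 2 ^ (r + 1))
  obtain ⟨p, hp, hpv⟩ := exists_binVal_eq (r + 1) ⌈a * 2 ^ (r + 1)⌉₊ (by
    rw [← Nat.cast_lt (α := ℝ)]
    push_cast
    linarith)
  refine ⟨p, hp, mem_kraftCheck.2 ⟨r, hi, hp, ?_, ?_⟩⟩
  · rw [hp, hpv, ← ha, le_div_iff₀ hpos]
    exact hc'
  · rw [hp, hpv, ha1, div_le_iff₀ hpos, add_mul, div_mul_cancel₀ _ hpos.ne']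
    linarith

/-- The prefix machine that answers the requests `it y`. -/
def kraftMachine (it : List Bool → ℕ → Option (ℕ × List Bool)) :
    List Bool → List Bool →. List Bool :=
  fun p y => Nat.rfindOpt (kraftCheck (it y) p)

theorem mem_kraftMachine {it : List Bool → ℕ → Option (ℕ × List Bool)} {p y x : List Bool} :
    x ∈ kraftMachine it p y ↔ ∃ i, x ∈ kraftCheck (it y) p i := by
  refine ⟨Nat.rfindOpt_spec, fun ⟨i, hi⟩ => ?_⟩
  have hd : (kraftMachine it p y).Dom := Nat.rfindOpt_dom.2 ⟨i, x, hi⟩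
  obtain ⟨j, hj⟩ := Nat.rfindOpt_spec ⟨hd, rfl⟩
  obtain rfl := (eq_of_mem_kraftCheck hi hj List.prefix_rfl).2
  rw [Option.mem_unique hi hj]
  exact Part.get_mem hd

theorem isPrefixMachine_kraftMachine {it : List Bool → ℕ → Option (ℕ × List Bool)}
    (hit : Primrec₂ it) : IsPrefixMachine (kraftMachine it) where
  prefix_free y p q hp hq hpq := by
    obtain ⟨i, hi⟩ := mem_kraftMachine.1 (Part.get_mem hp)
    obtain ⟨j, hj⟩ := mem_kraftMachine.1 (Part.get_mem hq)
    exact (eq_of_mem_kraftCheck hi hj hpq).1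
  partrec := by
    refine Partrec.rfindOpt (f := fun (a : List Bool × List Bool) i => kraftCheck (it a.2) a.1 i)
      (Primrec.to_comp ?_)
    have hacc : Primrec₂ fun (y : List Bool) (i : ℕ) => kraftAcc (it y) i := by
      refine Primrec.nat_rec (f := fun _ : List Bool => ((0, 0) : ℕ × ℕ))
        (g := fun y q => (it y q.1).elim q.2
          fun r => (q.2.1 * 2 ^ r.1 + 2 ^ q.2.2, q.2.2 + r.1)) (Primrec.const (0, 0)) ?_
      refine (Primrec.option_casesOn (o := fun q : List Bool × ℕ × ℕ × ℕ => it q.1 q.2.1)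
        (f := fun q => q.2.2)
        (g := fun q r => (q.2.2.1 * 2 ^ r.1 + 2 ^ q.2.2.2, q.2.2.2 + r.1)) ?_ ?_ ?_).of_eq ?_
      · exact hit.comp Primrec.fst (Primrec.fst.comp Primrec.snd)
      · exact Primrec.snd.comp Primrec.snd
      · have e1 : Primrec fun z : (List Bool × ℕ × ℕ × ℕ) × ℕ × List Bool => z.1.2.2.1 :=
          Primrec.fst.comp (Primrec.snd.comp (Primrec.snd.comp Primrec.fst))
        have e2 : Primrec fun z : (List Bool × ℕ × ℕ × ℕ) × ℕ × List Bool => z.1.2.2.2 :=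
          Primrec.snd.comp (Primrec.snd.comp (Primrec.snd.comp Primrec.fst))
        have e3 : Primrec fun z : (List Bool × ℕ × ℕ × ℕ) × ℕ × List Bool => z.2.1 :=
          Primrec.fst.comp Primrec.snd
        exact Primrec.pair
          (Primrec.nat_add.comp (Primrec.nat_mul.comp e1 (primrec₂_pow.comp (.const 2) e3))
            (primrec₂_pow.comp (.const 2) e2))
          (Primrec.nat_add.comp e2 e3)
      · rintro ⟨y, n, a⟩
        cases h : it y n <;> simp [h]
    refine Primrec.option_bind
      (f := fun a : (List Bool × List Bool) × ℕ => it a.1.2 a.2)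
      (hit.comp (Primrec.snd.comp Primrec.fst) Primrec.snd) ?_
    have ey : Primrec fun z : ((List Bool × List Bool) × ℕ) × ℕ × List Bool => z.1.1.2 :=
      Primrec.snd.comp (Primrec.fst.comp Primrec.fst)
    have ep : Primrec fun z : ((List Bool × List Bool) × ℕ) × ℕ × List Bool => z.1.1.1 :=
      Primrec.fst.comp (Primrec.fst.comp Primrec.fst)
    have ea : Primrec fun z : ((List Bool × List Bool) × ℕ) × ℕ × List Bool =>
        kraftAcc (it z.1.1.2) z.1.2 := hacc.comp ey (Primrec.snd.comp Primrec.fst)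
    have el : Primrec fun z : ((List Bool × List Bool) × ℕ) × ℕ × List Bool => z.1.1.1.length :=
      Primrec.list_length.comp ep
    have ev := primrec_binVal.comp ep
    have e2 := primrec₂_pow.comp (Primrec.const 2) (Primrec.snd.comp ea)
    have el2 := primrec₂_pow.comp (Primrec.const 2) el
    refine Primrec.ite (.and (PrimrecRel.comp Primrec.eq el
      (Primrec.succ.comp (Primrec.fst.comp Primrec.snd))) (.and ?_ ?_))
      (Primrec.option_some.comp (Primrec.snd.comp Primrec.snd)) (Primrec.const none)
    · exact PrimrecRel.comp Primrec.nat_le (Primrec.nat_mul.comp (Primrec.fst.comp ea) el2)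
        (Primrec.nat_mul.comp ev e2)
    · exact PrimrecRel.comp Primrec.nat_le
        (Primrec.nat_mul.comp (Primrec.succ.comp ev) e2)
        (Primrec.nat_add.comp (Primrec.nat_mul.comp (Primrec.fst.comp ea) el2)
          (Primrec.nat_mul.comp (Primrec.const 2) e2))

theorem condK_le_of_mem {U : List Bool → List Bool →. List Bool} {p x y : List Bool}
    (h : x ∈ U p y) : condK U x y ≤ p.length :=
  Nat.sInf_le ⟨p, rfl, h⟩

theorem exists_program_of_requests {U : List Bool → List Bool →. List Bool}
    (hU : IsOptimalPrefixMachine U) {it : List Bool → ℕ → Option (ℕ × List Bool)}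
    (hit : Primrec₂ it) (hsum : ∀ y n, ∑ j ∈ Finset.range n, requestWeight (it y j) ≤ 1) :
    ∃ c, ∀ y i r x, it y i = some (r, x) → ∃ p, x ∈ U p y ∧ p.length ≤ r + c := by
  obtain ⟨c, hc⟩ := hU.optimal _ (isPrefixMachine_kraftMachine hit)
  refine ⟨c + 1, fun y i r x h => ?_⟩
  obtain ⟨p, hp, hpx⟩ := exists_mem_kraftCheck (hsum y) h
  obtain ⟨q, hq, hql⟩ := hc p y x (mem_kraftMachine.2 ⟨i, hpx⟩)
  exact ⟨q, hq, by omega⟩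

end KraftMachine

/-- Keeping only the least stage lets an enumeration list each element exactly once, so that no
weight is counted twice. -/
theorem SemiDecidable.exists_unique_stage {α : Type*} [Primcodable α] {p : α → Prop}
    (hp : SemiDecidable p) : ∃ g : α → ℕ → Prop, PrimrecRel g ∧ (∀ a, p a ↔ ∃ t, g a t) ∧
      ∀ a t t', g a t → g a t' → t = t' := by
  classical
  obtain ⟨g, hg, hpg⟩ := hp
  refine ⟨fun a t => g a t ∧ ∀ t' < t, ¬ g a t', ?_, fun a => ?_, ?_⟩
  · refine PrimrecPred.and hg ?_
    have h1 : PrimrecRel fun (t : ℕ) (a : α) => ¬ g a t := PrimrecRel.not hg.swap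
    exact (PrimrecRel.comp h1.forall_mem_list (Primrec.list_range.comp Primrec.snd)
      Primrec.fst).of_eq fun z => by simp
  · rw [hpg]
    exact ⟨fun h => ⟨Nat.find h, Nat.find_spec h, fun _ => Nat.find_min h⟩,
      fun ⟨t, ht, _⟩ => ⟨t, ht⟩⟩
  · rintro a t t' ⟨h, hm⟩ ⟨h', hm'⟩
    by_contra hne
    rcases Nat.lt_or_gt_of_ne hne with hlt | hlt
    · exact hm' _ hlt h
    · exact hm _ hlt h'

/-- The weight `2 ^ (-n)`. -/
noncomputable def wt (n : ℕ) : ℝ≥0∞ := 2⁻¹ ^ n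

theorem wt_add (m n : ℕ) : wt (m + n) = wt m * wt n := pow_add _ _ _

theorem wt_ne_zero (n : ℕ) : wt n ≠ 0 := by simp [wt]

theorem wt_ne_top (n : ℕ) : wt n ≠ ⊤ := by simp [wt]

theorem wt_anti {m n : ℕ} (h : m ≤ n) : wt n ≤ wt m :=
  pow_le_pow_right_of_le_one' (by simp) h

theorem two_pow_mul_wt (n : ℕ) : (2 : ℝ≥0∞) ^ n * wt n = 1 := by
  rw [wt, ← mul_pow, ENNReal.mul_inv_cancel (by simp) (by simp), one_pow]

theorem ofReal_half_pow (n : ℕ) : ENNReal.ofReal ((1 / 2) ^ n) = wt n := by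
  rw [wt, ENNReal.ofReal_pow (by norm_num), one_div, ENNReal.ofReal_inv_of_pos (by norm_num)]
  simp

theorem tsum_wt : ∑' n, wt n = 2 := by
  simp only [wt, ENNReal.tsum_geometric]
  rw [ENNReal.one_sub_inv_two, inv_inv]

theorem tsum_le_tsum_of_injective {α β : Type*} {f : α → ℝ≥0∞} {g : β → ℝ≥0∞} (φ : α → β)
    (hφ : Function.Injective φ) (h : ∀ a, f a ≤ g (φ a)) : ∑' a, f a ≤ ∑' b, g b :=
  (ENNReal.tsum_le_tsum h).trans (ENNReal.tsum_comp_le_tsum_of_injective hφ g)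

/-- A semidecidable family of requests of bounded total weight can be answered: a form of the
Kraft-Chaitin theorem. -/
theorem exists_program_of_semiDecidable {U : List Bool → List Bool →. List Bool}
    (hU : IsOptimalPrefixMachine U) {Q : Type*} [Primcodable Q] {R : List Bool → Q → Prop}
    (hR : SemiDecidable fun z : List Bool × Q => R z.1 z.2) {r : Q → ℕ} (hr : Primrec r)
    {o : Q → List Bool} (ho : Primrec o) {B : ℝ≥0∞} (hB : B ≠ ⊤)
    (hsum : ∀ y, ∑' q : {q // R y q}, wt (r q) ≤ B) :
    ∃ c, ∀ y q, R y q → ∃ p, o q ∈ U p y ∧ p.length ≤ r q + c := by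
  classical
  obtain ⟨g, hg, hRg, huniq⟩ := hR.exists_unique_stage
  obtain ⟨C, hC⟩ : ∃ C : ℕ, B ≤ 2 ^ C := by
    obtain ⟨n, hn⟩ := ENNReal.exists_nat_gt hB
    refine ⟨n, hn.le.trans ?_⟩
    exact_mod_cast Nat.lt_two_pow_self.le
  -- Position i carries a request only if it codes a pair of a q and its unique stage. Lengthening
  -- every request by C bits brings the total weight below 1.
  let it : List Bool → ℕ → Option (ℕ × List Bool) := fun y i =>
    (Encodable.decode₂ (Q × ℕ) i).bind fun z =>
      if g (y, z.1) z.2 then some (r z.1 + C, o z.1) else none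
  have hit : Primrec₂ it := by
    refine Primrec.option_bind (Primrec.decode₂.comp Primrec.snd) ?_
    have eq : Primrec fun z : (List Bool × ℕ) × Q × ℕ => z.2.1 := Primrec.fst.comp Primrec.snd
    refine Primrec.ite (PrimrecRel.comp hg (Primrec.pair (Primrec.fst.comp Primrec.fst) eq)
      (Primrec.snd.comp Primrec.snd)) ?_ (Primrec.const none)
    exact Primrec.option_some.comp (Primrec.pair
      (Primrec.nat_add.comp (hr.comp eq) (Primrec.const C)) (ho.comp eq))
  have hstage : ∀ y (q : {q // R y q}), ∃ t, g (y, q) t := fun y q => (hRg (y, q)).1 q.2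
  choose τ hτ using hstage
  have hle : ∀ y i, ENNReal.ofReal (requestWeight (it y i))
      ≤ ∑' q : {q // R y q}, if i = Encodable.encode ((q : Q), τ y q) then wt (r q + C) else 0 := by
    intro y i
    rcases h : it y i with _ | ⟨r', x⟩
    · simp [requestWeight]
    · obtain ⟨⟨q, t⟩, hd, hz⟩ := Option.bind_eq_some_iff.1 h
      obtain ⟨hgz, heq⟩ := Option.ite_none_right_eq_some.1 hz
      simp only [Option.some.injEq, Prod.mk.injEq] at heq
      have hq : R y q := (hRg (y, q)).2 ⟨_, hgz⟩
      refine le_trans ?_ (ENNReal.le_tsum (⟨q, hq⟩ : {q // R y q}))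
      have hi : i = Encodable.encode (q, τ y ⟨q, hq⟩) := by
        rw [huniq _ _ _ (hτ y ⟨q, hq⟩) hgz]
        exact (Encodable.decode₂_eq_some.1 hd).symm
      rw [if_pos hi, ← heq.1]
      exact (ofReal_half_pow _).le
  have hreq : ∀ y n, ∑ j ∈ Finset.range n, requestWeight (it y j) ≤ 1 := by
    intro y n
    rw [← ENNReal.ofReal_le_one, ENNReal.ofReal_sum_of_nonneg fun i _ => requestWeight_nonneg _]
    calc _ ≤ ∑' i, ENNReal.ofReal (requestWeight (it y i)) := ENNReal.sum_le_tsum _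
      _ ≤ ∑' i, ∑' q : {q // R y q},
          if i = Encodable.encode ((q : Q), τ y q) then wt (r q + C) else 0 :=
        ENNReal.tsum_le_tsum (hle y)
      _ = ∑' q : {q // R y q}, wt (r q) * wt C := by
        rw [ENNReal.tsum_comm]
        simp only [tsum_ite_eq, wt_add]
      _ ≤ 2 ^ C * wt C := by
        rw [ENNReal.tsum_mul_right]
        gcongr
        exact (hsum y).trans hC
      _ = 1 := two_pow_mul_wt C
  obtain ⟨c, hc⟩ := exists_program_of_requests hU hit hreq
  refine ⟨C + c, fun y q hq => ?_⟩
  obtain ⟨p, hp, hpl⟩ := hc y (Encodable.encode (q, τ y ⟨q, hq⟩)) (r q + C) (o q) (by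
    simp only [it, Encodable.encodek₂, Option.bind_some, if_pos (hτ y ⟨q, hq⟩)])
  exact ⟨p, hp, by omega⟩

/-! ### Basic properties of the complexity -/

section Machine

variable {U : List Bool → List Bool →. List Bool}

theorem tsum_encodable_wt_le {α : Type*} [Encodable α] :
    ∑' a : α, wt (Encodable.encode a) ≤ 2 := by
  rw [← tsum_wt]
  exact ENNReal.tsum_comp_le_tsum_of_injective Encodable.encode_injective wt

/-- The code number of x is a wasteful but summable program length. Existence makes the infimum in
`condK` a genuine minimum. -/
theorem exists_program (hU : IsOptimalPrefixMachine U) (x y : List Bool) : ∃ p, x ∈ U p y := by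
  obtain ⟨c, hc⟩ := exists_program_of_semiDecidable hU (Q := List Bool) (R := fun _ _ => True)
    (.of_primrecPred primrecPred_const) (r := Encodable.encode) Primrec.encode
    (o := fun x => x) Primrec.id (B := 2) (by simp) fun y =>
      (tsum_le_tsum_of_injective Subtype.val Subtype.val_injective
        fun _ => le_rfl).trans tsum_encodable_wt_le
  obtain ⟨p, hp, -⟩ := hc y x trivial
  exact ⟨p, hp⟩

theorem exists_shortest_program (hU : IsOptimalPrefixMachine U) (x y : List Bool) :
    ∃ p : List Bool, p.length = condK U x y ∧ x ∈ U p y := by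
  obtain ⟨p, hp⟩ := exists_program hU x y
  exact Nat.sInf_mem (s := {n : ℕ | ∃ p : List Bool, p.length = n ∧ x ∈ U p y}) ⟨_, p, rfl, hp⟩

theorem condK_le_iff (hU : IsOptimalPrefixMachine U) {x y : List Bool} {n : ℕ} :
    condK U x y ≤ n ↔ ∃ p, p.length ≤ n ∧ x ∈ U p y := by
  constructor
  · intro h
    obtain ⟨p, hp, hx⟩ := exists_shortest_program hU x y
    exact ⟨p, hp.trans_le h, hx⟩
  · rintro ⟨p, hp, hx⟩
    exact (condK_le_of_mem hx).trans hp

theorem exists_condK_le (hU : IsOptimalPrefixMachine U) {Q : Type*} [Primcodable Q]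
    {R : List Bool → Q → Prop}
    (hR : SemiDecidable fun z : List Bool × Q => R z.1 z.2) {r : Q → ℕ} (hr : Primrec r)
    {o : Q → List Bool} (ho : Primrec o) {B : ℝ≥0∞} (hB : B ≠ ⊤)
    (hsum : ∀ y, ∑' q : {q // R y q}, wt (r q) ≤ B) :
    ∃ c, ∀ y q, R y q → condK U (o q) y ≤ r q + c := by
  obtain ⟨c, hc⟩ := exists_program_of_semiDecidable hU hR hr ho hB hsum
  exact ⟨c, fun y q hq => (condK_le_iff hU).2 (by
    obtain ⟨p, hp, hpl⟩ := hc y q hq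
    exact ⟨p, hpl, hp⟩)⟩

/-- Complexity can be approximated from above: run the programs of length at most n with a growing
bound on the resources of `evaln`. -/
theorem semiDecidable_condK_le (hU : IsOptimalPrefixMachine U) :
    SemiDecidable fun z : (List Bool × List Bool) × ℕ => condK U z.1.1 z.1.2 ≤ z.2 := by
  obtain ⟨code, hcode⟩ := Nat.Partrec.Code.exists_code.1 hU.partrec
  have hmem : ∀ p y x, x ∈ U p y ↔
      ∃ t, Encodable.encode x ∈ Nat.Partrec.Code.evaln t code (Encodable.encode (p, y)) := by
    intro p y x
    rw [← Nat.Partrec.Code.evaln_complete, hcode]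
    simp
  have h1 : SemiDecidable fun z : (List Bool × List Bool) × List Bool =>
      z.1.1 ∈ U z.2 z.1.2 := by
    refine ⟨fun z t => Nat.Partrec.Code.evaln t code (Encodable.encode (z.2, z.1.2))
      = some (Encodable.encode z.1.1), ?_, fun z => hmem _ _ _⟩
    refine PrimrecRel.comp Primrec.eq (Nat.Partrec.Code.primrec_evaln.comp
      (Primrec.pair (Primrec.pair Primrec.snd (Primrec.const code)) ?_)) ?_
    · exact Primrec.encode.comp (Primrec.pair (Primrec.snd.comp Primrec.fst)
        (Primrec.snd.comp (Primrec.fst.comp Primrec.fst)))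
    · exact Primrec.option_some.comp (Primrec.encode.comp
        (Primrec.fst.comp (Primrec.fst.comp Primrec.fst)))
  refine SemiDecidable.of_eq (SemiDecidable.exists_of (α := (List Bool × List Bool) × ℕ)
    (β := List Bool) (p := fun z p => p.length ≤ z.2 ∧ z.1.1 ∈ U p z.1.2) (.and
      (.of_primrecPred (PrimrecRel.comp Primrec.nat_le (Primrec.list_length.comp Primrec.snd)
        (Primrec.snd.comp Primrec.fst)))
      (h1.comp (Primrec.pair (Primrec.fst.comp Primrec.fst) Primrec.snd))))
    fun z => (condK_le_iff hU).symm

theorem SemiDecidable.condK_le (hU : IsOptimalPrefixMachine U) {α : Type*} [Primcodable α]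
    {f g : α → List Bool} {h : α → ℕ} (hf : Primrec f) (hg : Primrec g) (hh : Primrec h) :
    SemiDecidable fun a => condK U (f a) (g a) ≤ h a :=
  (semiDecidable_condK_le hU).comp (Primrec.pair (Primrec.pair hf hg) hh)

open InformationTheory in
theorem uniquelyDecodable_of_prefix_free {α : Type*} {S : Set (List α)} (hnil : [] ∉ S)
    (hS : ∀ p ∈ S, ∀ q ∈ S, p <+: q → p = q) : UniquelyDecodable S := by
  intro L₁
  induction L₁ with
  | nil =>
    intro L₂ _ h₂ h
    cases L₂ with
    | nil => rfl
    | cons w L =>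
      have : w = [] := by simp at h; exact h.1
      exact absurd (this ▸ h₂ w (by simp)) hnil
  | cons v L₁ ih =>
    intro L₂ h₁ h₂ h
    cases L₂ with
    | nil =>
      have : v = [] := by simp at h; exact h.1
      exact absurd (this ▸ h₁ v (by simp)) hnil
    | cons w L₂ =>
      simp only [List.flatten_cons] at h
      have hvw : v = w := by
        rcases List.prefix_or_prefix_of_prefix (List.prefix_append v L₁.flatten)
          (h ▸ List.prefix_append w L₂.flatten) with h' | h'
        · exact hS v (h₁ v (by simp)) w (h₂ w (by simp)) h'
        · exact (hS w (h₂ w (by simp)) v (h₁ v (by simp)) h').symm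
      subst hvw
      rw [ih L₂ (fun u hu => h₁ u (by simp [hu])) (fun u hu => h₂ u (by simp [hu]))
        (List.append_cancel_left h)]

open InformationTheory in
theorem kraft_of_prefix_free {S : Finset (List Bool)}
    (hS : ∀ p ∈ S, ∀ q ∈ S, p <+: q → p = q) : ∑ p ∈ S, wt p.length ≤ 1 := by
  -- McMillan's inequality applies to uniquely decodable codes, which exclude the empty word; a
  -- prefix-free set containing it is a singleton.
  by_cases hnil : [] ∈ S
  · have : S = {[]} := Finset.eq_singleton_iff_unique_mem.2
      ⟨hnil, fun q hq => (hS [] hnil q hq List.nil_prefix).symm⟩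
    simp [this, wt]
  · have h := kraft_mcmillan_inequality (S := S)
      (uniquelyDecodable_of_prefix_free (by simpa using hnil) (by simpa using hS))
    simp only [Fintype.card_bool, Nat.cast_ofNat] at h
    rw [← ENNReal.ofReal_le_one, ENNReal.ofReal_sum_of_nonneg fun i _ => by positivity] at h
    simpa only [ofReal_half_pow] using h

theorem tsum_wt_condK_le_one (hU : IsOptimalPrefixMachine U) (y : List Bool) :
    ∑' x, wt (condK U x y) ≤ 1 := by
  choose p hp hx using fun x => exists_shortest_program hU x y
  have hinj : Function.Injective p := fun x x' h => Part.mem_unique (hx x) (h ▸ hx x')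
  rw [ENNReal.tsum_eq_iSup_sum]
  refine iSup_le fun s => ?_
  have h := kraft_of_prefix_free (S := s.map ⟨p, hinj⟩) (by
    simp only [Finset.mem_map, Function.Embedding.coeFn_mk, forall_exists_index, and_imp,
      forall_apply_eq_imp_iff₂]
    exact fun x _ x' _ h => hU.prefix_free y _ _ (Part.dom_iff_mem.2 ⟨x, hx x⟩)
      (Part.dom_iff_mem.2 ⟨x', hx x'⟩) h)
  simpa [hp] using h

/-- Each such x has weight at least 2^(-n), and the total weight is at most 1. -/
theorem finite_condK_le (hU : IsOptimalPrefixMachine U) (y : List Bool) (n : ℕ) :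
    {x | condK U x y ≤ n}.Finite ∧ {x | condK U x y ≤ n}.ncard ≤ 2 ^ n := by
  have key : ∀ s : Finset (List Bool), (∀ x ∈ s, condK U x y ≤ n) → s.card ≤ 2 ^ n := by
    intro s hs
    have h1 : (s.card : ℝ≥0∞) * wt n ≤ 1 := by
      rw [← nsmul_eq_mul]
      calc _ ≤ ∑ x ∈ s, wt (condK U x y) :=
            Finset.card_nsmul_le_sum _ _ _ fun x hx => wt_anti (hs x hx)
        _ ≤ _ := (ENNReal.sum_le_tsum _).trans (tsum_wt_condK_le_one hU y)
    rw [← two_pow_mul_wt n, ENNReal.mul_le_mul_iff_left (wt_ne_zero n) (wt_ne_top n)] at h1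
    exact_mod_cast h1
  have hfin : {x | condK U x y ≤ n}.Finite := by
    by_contra hinf
    obtain ⟨s, hs, hcard⟩ := Set.Infinite.exists_subset_card_eq hinf (2 ^ n + 1)
    have := key s fun x hx => hs hx
    omega
  refine ⟨hfin, ?_⟩
  rw [Set.ncard_eq_toFinset_card _ hfin]
  exact key _ fun x hx => by simpa using hx

end Machine

/-! ### Describing an element by its rank in an enumeration -/

/-- The elements of a semidecidable family of sets can be ranked in the order of their
enumeration. -/
theorem SemiDecidable.exists_rank {α β : Type*} [Primcodable α] [Primcodable β]
    {S : α → β → Prop} (hS : SemiDecidable fun z : α × β => S z.1 z.2) :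
    ∃ rk : α → β → ℕ, (SemiDecidable fun z : (α × β) × ℕ => S z.1.1 z.1.2 ∧ rk z.1.1 z.1.2 < z.2) ∧
      (∀ a b b', S a b → S a b' → rk a b = rk a b' → b = b') ∧
      ∀ a b, S a b → {b | S a b}.Finite → rk a b < {b | S a b}.ncard := by
  classical
  obtain ⟨g, hg, hSg, huniq⟩ := hS.exists_unique_stage
  let hit : ℕ → α → Prop := fun i a => ∃ z ∈ Encodable.decode₂ (β × ℕ) i, g (a, z.1) z.2
  have hhit : PrimrecRel hit :=
    primrecPred_exists_mem_option (o := fun z : ℕ × α => Encodable.decode₂ (β × ℕ) z.1)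
      (q := fun z w => g (z.2, w.1) w.2) (Primrec.decode₂.comp Primrec.fst)
      (PrimrecRel.comp hg (Primrec.pair (Primrec.snd.comp Primrec.fst)
        (Primrec.fst.comp Primrec.snd)) (Primrec.snd.comp Primrec.snd))
  let τ : α → β → ℕ := fun a b => if h : ∃ t, g (a, b) t then h.choose else 0
  have hτ : ∀ a b, S a b → g (a, b) (τ a b) := fun a b h => by
    have h' := (hSg (a, b)).1 h
    simp only [τ, dif_pos h']
    exact h'.choose_spec
  -- The rank of b is the number of enumeration events with a code below that of b and its stage.
  -- Each member of the set produces exactly one event, so ranks are distinct and smaller than the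
  -- size of the set.
  let cnt : ℕ → α → ℕ := fun n a => ((List.range n).filter fun i => hit i a).length
  have hcnt : Primrec₂ cnt := Primrec.list_length.comp
    ((PrimrecRel.listFilter hhit).comp (Primrec.list_range.comp Primrec.fst) Primrec.snd)
  have hcount : ∀ n a, cnt n a = Nat.count (fun i => hit i a) n := fun n a => by
    rw [Nat.count_eq_card_filter_range]
    rfl
  have hhitτ : ∀ a b, S a b → hit (Encodable.encode (b, τ a b)) a := fun a b h =>
    ⟨(b, τ a b), Encodable.encodek₂ _, hτ a b h⟩
  refine ⟨fun a b => cnt (Encodable.encode (b, τ a b)) a, ?_, ?_, ?_⟩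
  · refine ⟨fun z t => g z.1 t ∧ cnt (Encodable.encode (z.1.2, t)) z.1.1 < z.2, ?_, ?_⟩
    · refine .and (PrimrecRel.comp hg (Primrec.fst.comp Primrec.fst) Primrec.snd)
        (PrimrecRel.comp Primrec.nat_lt (hcnt.comp (Primrec.encode.comp (Primrec.pair
          (Primrec.snd.comp (Primrec.fst.comp Primrec.fst)) Primrec.snd))
          (Primrec.fst.comp (Primrec.fst.comp Primrec.fst))) (Primrec.snd.comp Primrec.fst))
    · rintro ⟨⟨a, b⟩, n⟩
      constructor
      · rintro ⟨h, hn⟩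
        exact ⟨_, hτ a b h, hn⟩
      · rintro ⟨t, ht, hn⟩
        have h : S a b := (hSg (a, b)).2 ⟨t, ht⟩
        obtain rfl := huniq _ _ _ ht (hτ a b h)
        exact ⟨h, hn⟩
  · intro a b b' h h' heq
    simp only [hcount] at heq
    have := Encodable.encode_injective
      (Nat.count_injective (p := fun i => hit i a) (hhitτ a b h) (hhitτ a b' h') heq)
    exact (Prod.ext_iff.1 this).1
  · intro a b h hfin
    have hsub : ((Finset.range (Encodable.encode (b, τ a b))).filter fun i => hit i a)
        ⊆ (hfin.toFinset.erase b).image fun b' => Encodable.encode (b', τ a b') := by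
      intro i hi
      simp only [Finset.mem_filter, Finset.mem_range] at hi
      obtain ⟨hlt, ⟨b', t⟩, hd, hz⟩ := hi
      have hb' : S a b' := (hSg (a, b')).2 ⟨t, hz⟩
      obtain rfl := huniq _ _ _ hz (hτ a b' hb')
      have hi := Encodable.decode₂_eq_some.1 hd
      simp only [Finset.mem_image, Finset.mem_erase, Set.Finite.mem_toFinset, Set.mem_ofPred_eq]
      refine ⟨b', ⟨?_, hb'⟩, hi⟩
      rintro rfl
      omega
    have hle := (Finset.card_le_card hsub).trans Finset.card_image_le
    have hb : b ∈ hfin.toFinset := by simpa using h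
    rw [Finset.card_erase_of_mem hb, ← Set.ncard_eq_toFinset_card _ hfin] at hle
    have hpos : 0 < {b | S a b}.ncard := (Set.ncard_pos hfin).2 ⟨b, h⟩
    simp only [hcount, Nat.count_eq_card_filter_range]
    omega

/-- The length, up to a constant, of a self-delimiting code of the number `n`. -/
def natCost (n : ℕ) : ℕ :=
  Nat.log 2 (n + 1) + Nat.log 2 (n + 1) / 16

theorem natCost_mono {m n : ℕ} (h : m ≤ n) : natCost m ≤ natCost n := by
  have := Nat.log_mono_right (b := 2) (Nat.succ_le_succ h)
  exact Nat.add_le_add this (Nat.div_le_div_right this)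

theorem primrec_log_two_succ : Primrec fun n : ℕ => Nat.log 2 (n + 1) := by
  refine (Primrec.nat_findGreatest (f := fun n : ℕ => n) (p := fun n k => 2 ^ k ≤ n + 1)
    Primrec.id (PrimrecRel.comp Primrec.nat_le (primrec₂_pow.comp (Primrec.const 2) Primrec.snd)
      (Primrec.succ.comp Primrec.fst))).of_eq fun n => ?_
  rw [Nat.findGreatest_eq_iff]
  refine ⟨?_, fun _ => Nat.pow_log_le_self 2 (by omega), fun k hk _ hk' => ?_⟩
  · have := Nat.log_lt_self 2 (x := n + 1) (by omega)
    omega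
  · exact absurd (Nat.le_log_of_pow_le (by norm_num) hk') (by omega)

theorem primrec_natCost : Primrec natCost :=
  Primrec.nat_add.comp primrec_log_two_succ
    (Primrec.nat_div.comp primrec_log_two_succ (Primrec.const 16))

theorem natCost_le (n : ℕ) : (natCost n : ℝ) ≤ 17 / 16 * Real.logb 2 (n + 1) := by
  have h1 : ((Nat.log 2 (n + 1) : ℕ) : ℝ) ≤ Real.logb 2 (n + 1) := by
    have := Real.natLog_le_logb (n + 1) 2
    push_cast at this
    exact this
  have h2 : ((Nat.log 2 (n + 1) / 16 : ℕ) : ℝ) ≤ (Nat.log 2 (n + 1) : ℕ) / 16 := by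
    have := Nat.cast_div_le (α := ℝ) (m := Nat.log 2 (n + 1)) (n := 16)
    exact_mod_cast this
  rw [natCost]
  push_cast
  linarith

/-- Up to rounding, the weight of n is (n+1)^(-17/16), a convergent series; the factor 8 absorbs
both roundings. Any exponent above 1 gives convergence, and one close to 1 keeps the final
coefficients of log s small. -/
theorem tsum_wt_natCost_ne_top : ∑' n, wt (natCost n) ≠ ⊤ := by
  have hsum : Summable fun n : ℕ => 8 * (1 / ((n + 1 : ℕ) : ℝ) ^ (17 / 16 : ℝ)) :=
    (((summable_nat_add_iff 1).2 (Real.summable_one_div_nat_rpow.2 (by norm_num))).mul_left 8)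
  refine ne_top_of_le_ne_top hsum.tsum_ofReal_ne_top (ENNReal.tsum_le_tsum fun n => ?_)
  rw [← ofReal_half_pow]
  refine ENNReal.ofReal_le_ofReal ?_
  have hlog : Real.logb 2 (n + 1) < Nat.log 2 (n + 1) + 1 := by
    rw [Real.logb_lt_iff_lt_rpow (by norm_num) (by positivity)]
    exact_mod_cast Nat.lt_pow_succ_log_self (b := 2) (by norm_num) (n + 1)
  have hdiv : (Nat.log 2 (n + 1) : ℝ) / 16 < ((Nat.log 2 (n + 1) / 16 : ℕ) : ℝ) + 1 := by
    rw [div_lt_iff₀ (by norm_num)]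
    exact_mod_cast (by omega : Nat.log 2 (n + 1) < (Nat.log 2 (n + 1) / 16 + 1) * 16)
  have hcost : 17 / 16 * Real.logb 2 (n + 1) ≤ natCost n + 3 := by
    rw [natCost]
    push_cast
    linarith
  have h1 : ((n + 1 : ℕ) : ℝ) ^ (17 / 16 : ℝ) ≤ 2 ^ (natCost n) * 8 := by
    calc ((n + 1 : ℕ) : ℝ) ^ (17 / 16 : ℝ)
        = (2 : ℝ) ^ (17 / 16 * Real.logb 2 (n + 1)) := by
          rw [mul_comm, Real.rpow_mul (by norm_num), Real.rpow_logb (by norm_num) (by norm_num)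
            (by positivity)]
          push_cast
          rfl
      _ ≤ (2 : ℝ) ^ ((natCost n + 3 : ℕ) : ℝ) := by
          refine Real.rpow_le_rpow_of_exponent_le (by norm_num) ?_
          push_cast
          exact hcost
      _ = _ := by rw [Real.rpow_natCast, pow_add]; norm_num
  rw [one_div_pow, mul_one_div, div_le_div_iff₀ (by positivity) (by positivity), one_mul, mul_comm]
  exact h1

/-- An element of a semidecidable family of finite sets is described by the index of the set, the
logarithm `n` of the size of the set, and `n` bits. -/
theorem exists_condK_le_of_ncard_le {U : List Bool → List Bool →. List Bool}
    (hU : IsOptimalPrefixMachine U) {Q : Type*} [Primcodable Q]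
    {S : List Bool × Q → List Bool → Prop}
    (hS : SemiDecidable fun z : (List Bool × Q) × List Bool => S z.1 z.2)
    {r : Q → ℕ} (hr : Primrec r) (hsum : ∑' q, wt (r q) ≠ ⊤) :
    ∃ c, ∀ y q x n, S (y, q) x → {x | S (y, q) x}.Finite → {x | S (y, q) x}.ncard ≤ 2 ^ n →
      condK U x y ≤ n + natCost n + r q + c := by
  -- For each pair (q, n), at most 2^n elements have rank below 2^n. The n bits for the rank cancel
  -- this number, leaving the summable weights of n and q.
  obtain ⟨rk, hrk, hinj, hlt⟩ := hS.exists_rank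
  obtain ⟨c, hc⟩ := exists_condK_le hU (Q := (Q × ℕ) × List Bool)
    (R := fun y z => S (y, z.1.1) z.2 ∧ rk (y, z.1.1) z.2 < 2 ^ z.1.2)
    (hrk.comp (f := fun w : List Bool × (Q × ℕ) × List Bool =>
        (((w.1, w.2.1.1), w.2.2), 2 ^ w.2.1.2)) (by
      have e1 : Primrec fun w : List Bool × (Q × ℕ) × List Bool => w.2.1.1 :=
        Primrec.fst.comp (Primrec.fst.comp Primrec.snd)
      have e2 : Primrec fun w : List Bool × (Q × ℕ) × List Bool => w.2.1.2 :=
        Primrec.snd.comp (Primrec.fst.comp Primrec.snd)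
      exact Primrec.pair (Primrec.pair (Primrec.pair Primrec.fst e1)
        (Primrec.snd.comp Primrec.snd)) (primrec₂_pow.comp (Primrec.const 2) e2)))
    (r := fun z => z.1.2 + natCost z.1.2 + r z.1.1)
    (Primrec.nat_add.comp (Primrec.nat_add.comp (Primrec.snd.comp Primrec.fst)
      (primrec_natCost.comp (Primrec.snd.comp Primrec.fst)))
      (hr.comp (Primrec.fst.comp Primrec.fst)))
    (o := fun z => z.2) Primrec.snd
    (B := (∑' n, wt (natCost n)) * ∑' q, wt (r q))
    (ENNReal.mul_ne_top tsum_wt_natCost_ne_top hsum) fun y => by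
      calc _ ≤ ∑' z : Σ p : Q × ℕ, Fin (2 ^ p.2),
            wt (z.1.2 + natCost z.1.2 + r z.1.1) := by
            refine tsum_le_tsum_of_injective
              (fun z => ⟨z.1.1, ⟨rk (y, z.1.1.1) z.1.2, z.2.2⟩⟩) ?_ fun _ => le_rfl
            rintro ⟨⟨⟨q, n⟩, x⟩, hS, hz⟩ ⟨⟨⟨q', n'⟩, x'⟩, hS', hz'⟩ h
            simp only [Sigma.mk.injEq, Prod.mk.injEq] at h
            obtain ⟨⟨rfl, rfl⟩, h⟩ := h
            simp only [heq_eq_eq, Fin.mk.injEq] at h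
            simp only [Subtype.mk.injEq, Prod.mk.injEq, true_and]
            exact hinj _ _ _ hS hS' h
        _ = ∑' p : Q × ℕ, wt (r p.1) * wt (natCost p.2) := by
            rw [ENNReal.tsum_sigma (fun (p : Q × ℕ) (_ : Fin (2 ^ p.2)) =>
              wt (p.2 + natCost p.2 + r p.1))]
            refine tsum_congr fun p => ?_
            simp only [tsum_fintype, Finset.sum_const, Finset.card_univ, Fintype.card_fin,
              nsmul_eq_mul, Nat.cast_pow, Nat.cast_ofNat]
            rw [wt_add, wt_add, ← mul_assoc, ← mul_assoc, two_pow_mul_wt, one_mul, mul_comm]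
        _ = _ := by
            rw [ENNReal.tsum_prod (f := fun q n => wt (r q) * wt (natCost n))]
            simp only [ENNReal.tsum_mul_left, ENNReal.tsum_mul_right]
            rw [mul_comm]
        _ ≤ _ := le_rfl
  refine ⟨c, fun y q x n hx hfin hcard => ?_⟩
  exact hc y ((q, n), x) ⟨hx, (hlt _ _ hx hfin).trans_le hcard⟩

/-! ### Coding of tuples -/

theorem selfDelim_append_inj {w w' u u' : List Bool}
    (h : selfDelim w ++ u = selfDelim w' ++ u') : w = w' ∧ u = u' := by
  induction w generalizing w' with
  | nil =>
    cases w' with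
    | nil => simpa [selfDelim] using h
    | cons b w' => simp [selfDelim] at h
  | cons b w ih =>
    cases w' with
    | nil => simp [selfDelim] at h
    | cons b' w' =>
      have h' : b = b' ∧ selfDelim w ++ u = selfDelim w' ++ u' := by
        simpa [selfDelim] using h
      obtain ⟨h1, h2⟩ := ih h'.2
      exact ⟨by rw [h'.1, h1], h2⟩

theorem encodeTuple_map_eq_iff {ι : Type*} (x x' : ι → List Bool) (l : List ι) :
    encodeTuple (l.map x) = encodeTuple (l.map x') ↔ ∀ i ∈ l, x i = x' i := by
  induction l with
  | nil => simp
  | cons i l ih =>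
    simp only [List.map_cons, encodeTuple, List.flatMap_cons, List.mem_cons,
      forall_eq_or_imp] at ih ⊢
    constructor
    · intro h
      obtain ⟨h1, h2⟩ := selfDelim_append_inj h
      exact ⟨h1, ih.1 h2⟩
    · rintro ⟨h1, h2⟩
      rw [h1, ih.2 h2]

section Sub

variable {m : ℕ}

theorem sub_eq_sub_iff {x x' : Fin m → List Bool} {I : Finset (Fin m)} :
    sub x I = sub x' I ↔ ∀ i ∈ I, x i = x' i := by
  rw [sub, sub, encodeTuple_map_eq_iff]
  simp

theorem sub_empty (x : Fin m → List Bool) : sub x ∅ = [] := by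
  simp [sub, encodeTuple]

theorem sub_eq_sub_of_subset {x x' : Fin m → List Bool} {I J : Finset (Fin m)} (h : I ⊆ J)
    (hx : sub x J = sub x' J) : sub x I = sub x' I :=
  sub_eq_sub_iff.2 fun i hi => sub_eq_sub_iff.1 hx i (h hi)

theorem sub_univ_injective : Function.Injective fun x : Fin m → List Bool => sub x Finset.univ :=
  fun _ _ h => funext fun i => sub_eq_sub_iff.1 h i (Finset.mem_univ i)

theorem primrec_selfDelim : Primrec selfDelim := by
  refine Primrec.list_append.comp (Primrec.list_flatMap Primrec.id ?_) (Primrec.const _)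
  exact (Primrec.dom_bool fun b => [true, b]).comp Primrec.snd

theorem primrec_sub (I : Finset (Fin m)) : Primrec fun x : Fin m → List Bool => sub x I := by
  have h : ∀ l : List (Fin m), Primrec fun x : Fin m → List Bool => encodeTuple (l.map x) := by
    intro l
    induction l with
    | nil => exact Primrec.const _
    | cons i l ih =>
      exact Primrec.list_append.comp
        (primrec_selfDelim.comp (Primrec.fin_app.comp Primrec.id (Primrec.const i))) ih
  exact h _

/-- `w = x_I` and `v = x_J` for some tuple `x`. -/
theorem semiDecidable_sub_eq {α : Type*} [Primcodable α] (I J : Finset (Fin m))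
    {f g : α → List Bool} (hf : Primrec f) (hg : Primrec g) :
    SemiDecidable fun a => ∃ x : Fin m → List Bool, f a = sub x I ∧ g a = sub x J := by
  refine SemiDecidable.exists_of (.of_primrecPred (.and ?_ ?_))
  · exact PrimrecRel.comp Primrec.eq (hf.comp Primrec.fst) ((primrec_sub I).comp Primrec.snd)
  · exact PrimrecRel.comp Primrec.eq (hg.comp Primrec.fst) ((primrec_sub J).comp Primrec.snd)

end Sub

/-! ### The chain rule, easy direction -/

section Complexity

variable {U : List Bool → List Bool →. List Bool}

theorem tsum_tsum_wt_add (f : List Bool → ℕ) :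
    ∑' v, ∑' i, wt (f v + i) = 2 * ∑' v, wt (f v) := by
  simp only [wt_add, ENNReal.tsum_mul_left, tsum_wt, ENNReal.tsum_mul_right]
  rw [mul_comm]

/-- Describe v from y, then u from v, and compute w from the pair. Complexities can only be
approximated from above, so a request is made for every pair of upper bounds a and b. Summing over
the excess of each costs a factor 2, which gives total weight at most 4. -/
theorem exists_condK_le_add (hU : IsOptimalPrefixMachine U)
    {T : List Bool → List Bool × List Bool → Prop}
    (hT : SemiDecidable fun z : List Bool × List Bool × List Bool => T z.1 z.2)
    (hfun : ∀ w w' v, T w v → T w' v → w = w') :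
    ∃ c, ∀ y w v u, T w (v, u) → condK U w y ≤ condK U v y + condK U u v + c := by
  obtain ⟨c, hc⟩ := exists_condK_le hU (Q := (List Bool × List Bool × List Bool) × ℕ × ℕ)
    (R := fun y q => T q.1.1 q.1.2 ∧ condK U q.1.2.1 y ≤ q.2.1 ∧ condK U q.1.2.2 q.1.2.1 ≤ q.2.2)
    (by
      have e1 : Primrec fun z : List Bool × (List Bool × List Bool × List Bool) × ℕ × ℕ =>
        z.2.1.2.1 := Primrec.fst.comp (Primrec.snd.comp (Primrec.fst.comp Primrec.snd))
      have e2 : Primrec fun z : List Bool × (List Bool × List Bool × List Bool) × ℕ × ℕ =>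
        z.2.1.2.2 := Primrec.snd.comp (Primrec.snd.comp (Primrec.fst.comp Primrec.snd))
      exact (hT.comp (Primrec.fst.comp Primrec.snd)).and
        ((SemiDecidable.condK_le hU e1 Primrec.fst
          (Primrec.fst.comp (Primrec.snd.comp Primrec.snd))).and
        (SemiDecidable.condK_le hU e2 e1 (Primrec.snd.comp (Primrec.snd.comp Primrec.snd)))))
    (r := fun q => q.2.1 + q.2.2)
    (Primrec.nat_add.comp (Primrec.fst.comp Primrec.snd) (Primrec.snd.comp Primrec.snd))
    (o := fun q => q.1.1) (Primrec.fst.comp Primrec.fst) (B := 4) (by simp) (fun y => by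
      calc _ ≤ ∑' z : (List Bool × ℕ) × List Bool × ℕ,
            wt (condK U z.1.1 y + z.1.2) * wt (condK U z.2.1 z.1.1 + z.2.2) := by
            refine tsum_le_tsum_of_injective (fun q => ((q.1.1.2.1, q.1.2.1 - condK U q.1.1.2.1 y),
              q.1.1.2.2, q.1.2.2 - condK U q.1.1.2.2 q.1.1.2.1)) ?_ ?_
            · rintro ⟨⟨⟨w, v, u⟩, a, b⟩, h1, h2, h3⟩ ⟨⟨⟨w', v', u'⟩, a', b'⟩, h1', h2', h3'⟩ h
              simp only [Prod.mk.injEq] at h h1 h2 h3 h1' h2' h3'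
              obtain ⟨⟨rfl, h4⟩, rfl, h5⟩ := h
              obtain rfl := hfun _ _ _ h1 h1'
              simp only [Subtype.mk.injEq, Prod.mk.injEq, true_and]
              omega
            · rintro ⟨⟨⟨w, v, u⟩, a, b⟩, h1, h2, h3⟩
              simp only at h2 h3
              rw [← wt_add, Nat.add_sub_cancel' h2, Nat.add_sub_cancel' h3]
        _ = ∑' z : List Bool × ℕ, wt (condK U z.1 y + z.2) *
              (2 * ∑' u, wt (condK U u z.1)) := by
            rw [ENNReal.tsum_prod (f := fun (z z' : List Bool × ℕ) =>
              wt (condK U z.1 y + z.2) * wt (condK U z'.1 z.1 + z'.2))]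
            refine tsum_congr fun z => ?_
            rw [ENNReal.tsum_mul_left,
              ENNReal.tsum_prod (f := fun u i => wt (condK U u z.1 + i)), tsum_tsum_wt_add]
        _ ≤ ∑' z : List Bool × ℕ, wt (condK U z.1 y + z.2) * 2 := by
            refine ENNReal.tsum_le_tsum fun z => ?_
            gcongr
            calc _ ≤ 2 * (1 : ℝ≥0∞) := by gcongr; exact tsum_wt_condK_le_one hU _
              _ = 2 := mul_one 2
        _ ≤ 4 := by
            rw [ENNReal.tsum_mul_right,
              ENNReal.tsum_prod (f := fun v i => wt (condK U v y + i)), tsum_tsum_wt_add]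
            calc _ ≤ 2 * (1 : ℝ≥0∞) * 2 := by gcongr; exact tsum_wt_condK_le_one hU _
              _ = 4 := by norm_num)
  exact ⟨c, fun y w v u h => hc y ((w, v, u), condK U v y, condK U u v) ⟨h, le_rfl, le_rfl⟩⟩

theorem exists_condK_nil_le (hU : IsOptimalPrefixMachine U) : ∃ c, ∀ y, condK U [] y ≤ c := by
  obtain ⟨c, hc⟩ := exists_condK_le hU (Q := Unit) (R := fun _ _ => True)
    (.of_primrecPred primrecPred_const) (r := fun _ => 0) (Primrec.const 0)
    (o := fun _ => []) (Primrec.const []) (B := 1) (by simp) fun y =>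
      (tsum_le_tsum_of_injective (g := fun _ : Unit => 1) Subtype.val Subtype.val_injective
        fun _ => by simp [wt]).trans (by simp)
  exact ⟨c, fun y => by simpa using hc y () trivial⟩

variable {m : ℕ}

theorem exists_condK_sub_le_of_subset (hU : IsOptimalPrefixMachine U) {I J : Finset (Fin m)}
    (h : I ⊆ J) : ∃ c, ∀ (x : Fin m → List Bool) y,
      condK U (sub x I) y ≤ condK U (sub x J) y + c := by
  obtain ⟨c, hc⟩ := exists_condK_le_add hU
    (T := fun w v => ∃ x : Fin m → List Bool, w = sub x I ∧ v.1 = sub x J)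
    (semiDecidable_sub_eq I J Primrec.fst (Primrec.fst.comp Primrec.snd)) (by
      rintro _ _ v ⟨x, rfl, hx⟩ ⟨x', rfl, hx'⟩
      exact sub_eq_sub_of_subset h (hx.symm.trans hx'))
  obtain ⟨c', hc'⟩ := exists_condK_nil_le hU
  refine ⟨c' + c, fun x y => ?_⟩
  -- Here w depends on v alone, so the empty string serves as second component, at bounded cost.
  have := hc y (sub x I) (sub x J) [] ⟨x, rfl, rfl⟩
  have := hc' (sub x J)
  omega

theorem sub_union_eq {x x' : Fin m → List Bool} {I J : Finset (Fin m)}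
    (hI : sub x I = sub x' I) (hJ : sub x J = sub x' J) : sub x (I ∪ J) = sub x' (I ∪ J) :=
  sub_eq_sub_iff.2 fun i hi => (Finset.mem_union.1 hi).elim
    (sub_eq_sub_iff.1 hI i) (sub_eq_sub_iff.1 hJ i)

theorem exists_condK_sub_union_le (hU : IsOptimalPrefixMachine U) (I J : Finset (Fin m)) :
    ∃ c, ∀ (x : Fin m → List Bool) y, condK U (sub x (I ∪ J)) y
      ≤ condK U (sub x J) y + condK U (sub x I) (sub x J) + c := by
  obtain ⟨c, hc⟩ := exists_condK_le_add hU
    (T := fun w v => ∃ x : Fin m → List Bool, w = sub x (I ∪ J) ∧ v = (sub x J, sub x I)) (by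
      refine SemiDecidable.exists_of (.of_primrecPred (.and ?_ ?_))
      · exact PrimrecRel.comp Primrec.eq (Primrec.fst.comp Primrec.fst)
          ((primrec_sub _).comp Primrec.snd)
      · exact PrimrecRel.comp Primrec.eq (Primrec.snd.comp Primrec.fst)
          (Primrec.pair ((primrec_sub _).comp Primrec.snd) ((primrec_sub _).comp Primrec.snd))) (by
      rintro _ _ v ⟨x, rfl, hx⟩ ⟨x', rfl, hx'⟩
      rw [hx, Prod.mk.injEq] at hx'
      exact sub_union_eq hx'.2 hx'.1)
  exact ⟨c, fun x y => hc y _ _ _ ⟨x, rfl, rfl⟩⟩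

theorem exists_condK_sub_self_le (hU : IsOptimalPrefixMachine U) (I J : Finset (Fin m)) :
    ∃ c, ∀ x : Fin m → List Bool,
      condK U (sub x I) (sub x J) ≤ condK U (sub x (I ∪ J)) (sub x J) + c := by
  obtain ⟨c, hc⟩ := exists_condK_sub_le_of_subset hU (Finset.subset_union_left (s₁ := I) (s₂ := J))
  exact ⟨c, fun x => hc x _⟩

end Complexity

/-! ### Symmetry of information -/

open scoped Classical in
-- The powers of 2 up to N form a geometric series, whose sum is less than twice its largest term.
-- It pays for requesting the same string once for every n below the logarithm of its number of
-- extensions.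
theorem tsum_ite_two_pow_le (N : ℝ≥0∞) :
    ∑' n : ℕ, (if (2 : ℝ≥0∞) ^ n ≤ N then (2 : ℝ≥0∞) ^ n else 0) ≤ 2 * N := by
  have hgeom : ∀ k : ℕ, ∑ n ∈ Finset.range k, (2 : ℝ≥0∞) ^ n ≤ 2 ^ k := by
    intro k
    induction k with
    | zero => simp
    | succ k ih => rw [Finset.sum_range_succ, pow_succ, mul_two]; gcongr
  refine ENNReal.tsum_le_of_sum_range_le fun k => ?_
  induction k with
  | zero => simp
  | succ k ih =>
    by_cases h : (2 : ℝ≥0∞) ^ k ≤ N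
    · calc _ ≤ ∑ n ∈ Finset.range (k + 1), (2 : ℝ≥0∞) ^ n :=
            Finset.sum_le_sum fun n _ => by split_ifs <;> simp
        _ ≤ 2 ^ (k + 1) := hgeom _
        _ ≤ 2 * N := by rw [pow_succ, mul_comm]; gcongr
    · rw [Finset.sum_range_succ, if_neg h, add_zero]
      exact ih

section Symmetry

variable {U : List Bool → List Bool →. List Bool} {m : ℕ}

/-- `w` is a possible value of `x_I` with complexity at most `t`, for a tuple with `x_J = v`. -/
def IsExtension (U : List Bool → List Bool →. List Bool) (I J : Finset (Fin m)) (t : ℕ)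
    (v w : List Bool) : Prop :=
  K U w ≤ t ∧ ∃ x : Fin m → List Bool, w = sub x I ∧ v = sub x J

theorem semiDecidable_isExtension (hU : IsOptimalPrefixMachine U) (I J : Finset (Fin m))
    {α : Type*} [Primcodable α] {t : α → ℕ} {v w : α → List Bool} (ht : Primrec t)
    (hv : Primrec v) (hw : Primrec w) :
    SemiDecidable fun a => IsExtension U I J (t a) (v a) (w a) :=
  (SemiDecidable.condK_le hU hw (Primrec.const []) ht).and (semiDecidable_sub_eq I J hw hv)

theorem IsExtension.unique {I J : Finset (Fin m)} (h : J ⊆ I) {t : ℕ} {v v' w : List Bool}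
    (hv : IsExtension U I J t v w) (hv' : IsExtension U I J t v' w) : v = v' := by
  obtain ⟨-, x, hx, rfl⟩ := hv
  obtain ⟨-, x', hx', rfl⟩ := hv'
  exact sub_eq_sub_of_subset h (hx.symm.trans hx')

theorem finite_isExtension (hU : IsOptimalPrefixMachine U) (I J : Finset (Fin m)) (t : ℕ)
    (v : List Bool) : {w | IsExtension U I J t v w}.Finite ∧
      {w | IsExtension U I J t v w}.ncard ≤ 2 ^ t := by
  obtain ⟨h1, h2⟩ := finite_condK_le hU [] t
  have hsub : {w | IsExtension U I J t v w} ⊆ {w | condK U w [] ≤ t} := fun w hw => hw.1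
  exact ⟨h1.subset hsub, (Set.ncard_le_ncard hsub h1).trans h2⟩

/-- As J ⊆ I, an extension w determines v, so different v have disjoint sets of extensions; together
these contain at most 2^t strings. -/
theorem tsum_isExtension_le (hU : IsOptimalPrefixMachine U) {I J : Finset (Fin m)} (h : J ⊆ I)
    (t : ℕ) : ∑' (v) (_ : {w // IsExtension U I J t v w}), (1 : ℝ≥0∞) ≤ 2 ^ t := by
  rw [← ENNReal.tsum_sigma' (fun _ : Σ v, {w // IsExtension U I J t v w} => (1 : ℝ≥0∞))]
  calc _ ≤ ∑' w, 2 ^ t * wt (condK U w []) := by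
        refine tsum_le_tsum_of_injective (fun z => (z.2 : List Bool)) ?_ fun z => ?_
        · rintro ⟨v, w, hw⟩ ⟨v', w', hw'⟩ heq
          obtain rfl : w = w' := heq
          obtain rfl := hw.unique h hw'
          rfl
        · rw [← two_pow_mul_wt t]
          gcongr
          exact wt_anti z.2.2.1
    _ ≤ 2 ^ t * 1 := by
        rw [ENNReal.tsum_mul_left]
        gcongr
        exact tsum_wt_condK_le_one hU []
    _ = 2 ^ t := mul_one _

/-- Strings with many simple extensions are few, hence simple. A string v with N extensions of
complexity at most t is given weight about N·2^(-t); these weights sum to O(1) over v for fixed t,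
and the weight of t itself makes the sum over t converge. -/
theorem exists_condK_add_log_le (hU : IsOptimalPrefixMachine U) {I J : Finset (Fin m)}
    (h : J ⊆ I) : ∃ c, ∀ t n v, 2 ^ n ≤ {w | IsExtension U I J t v w}.ncard →
      K U v + n ≤ t + natCost t + c := by
  classical
  obtain ⟨c, hc⟩ := exists_condK_le hU (Q := (ℕ × List Bool) × ℕ)
    (R := fun _ q => ∃ l : List (List Bool), l.Nodup ∧ l.length = 2 ^ q.2 ∧
      ∀ w ∈ l, IsExtension U I J q.1.1 q.1.2 w)
    ((SemiDecidable.exists_nodup_list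
      (p := fun (a : ℕ × List Bool) w => IsExtension U I J a.1 a.2 w)
      (semiDecidable_isExtension hU I J (Primrec.fst.comp Primrec.fst)
        (Primrec.snd.comp Primrec.fst) Primrec.snd)).comp
      (f := fun z : List Bool × (ℕ × List Bool) × ℕ => (z.2.1, 2 ^ z.2.2))
      (Primrec.pair (Primrec.fst.comp Primrec.snd)
        (primrec₂_pow.comp (Primrec.const 2) (Primrec.snd.comp Primrec.snd))))
    (r := fun q => q.1.1 - q.2 + natCost q.1.1)
    (Primrec.nat_add.comp (Primrec.nat_sub.comp (Primrec.fst.comp Primrec.fst) Primrec.snd)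
      (primrec_natCost.comp (Primrec.fst.comp Primrec.fst)))
    (o := fun q => q.1.2) (Primrec.snd.comp Primrec.fst)
    (B := ∑' t, wt (natCost t) * 2) (by
      rw [ENNReal.tsum_mul_right]
      exact ENNReal.mul_ne_top tsum_wt_natCost_ne_top (by simp)) (fun y => by
      calc _ ≤ ∑' z : (ℕ × List Bool) × ℕ, wt (natCost z.1.1) * wt z.1.1 *
            (if (2 : ℝ≥0∞) ^ z.2 ≤ ∑' _ : {w // IsExtension U I J z.1.1 z.1.2 w}, 1
              then 2 ^ z.2 else 0) := by
            refine tsum_le_tsum_of_injective Subtype.val Subtype.val_injective ?_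
            rintro ⟨⟨⟨t, v⟩, n⟩, l, hl, hlen, hext⟩
            simp only at hlen hext ⊢
            have hcard : (2 : ℝ≥0∞) ^ n ≤ ∑' _ : {w // IsExtension U I J t v w}, 1 := by
              have h1 := ENNReal.sum_le_tsum (f := fun _ : {w // IsExtension U I J t v w} =>
                (1 : ℝ≥0∞)) (l.toFinset.subtype _)
              refine le_trans (le_of_eq ?_) h1
              rw [Finset.sum_const, Finset.card_subtype,
                Finset.filter_true_of_mem (by simpa using hext),
                List.toFinset_card_of_nodup hl, hlen]
              simp
            rw [if_pos hcard]
            -- This makes the truncated subtraction t - n exact.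
            have hn : n ≤ t := by
              have h2 : (2 : ℝ≥0∞) ^ n ≤ 2 ^ t := hcard.trans ((ENNReal.le_tsum
                (f := fun v => ∑' _ : {w // IsExtension U I J t v w}, (1 : ℝ≥0∞)) v).trans
                (tsum_isExtension_le hU h t))
              exact (Nat.pow_le_pow_iff_right (a := 2) (by norm_num)).1 (by exact_mod_cast h2)
            rw [wt_add, mul_comm, mul_assoc]
            gcongr
            obtain ⟨j, rfl⟩ := Nat.exists_eq_add_of_le hn
            rw [Nat.add_sub_cancel_left, wt_add, mul_assoc, mul_comm (wt j), ← mul_assoc,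
              mul_comm (wt n), two_pow_mul_wt, one_mul]
        _ = ∑' t, ∑' v, wt (natCost t) * wt t * ∑' n : ℕ,
            (if (2 : ℝ≥0∞) ^ n ≤ ∑' _ : {w // IsExtension U I J t v w}, 1
              then (2 : ℝ≥0∞) ^ n else 0) := by
            rw [ENNReal.tsum_prod (f := fun (p : ℕ × List Bool) (n : ℕ) =>
              wt (natCost p.1) * wt p.1 *
              (if (2 : ℝ≥0∞) ^ n ≤ ∑' _ : {w // IsExtension U I J p.1 p.2 w}, 1
              then (2 : ℝ≥0∞) ^ n else 0)),
              ENNReal.tsum_prod (f := fun t v => ∑' n : ℕ, wt (natCost t) * wt t *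
              (if (2 : ℝ≥0∞) ^ n ≤ ∑' _ : {w // IsExtension U I J t v w}, 1
              then (2 : ℝ≥0∞) ^ n else 0))]
            simp only [ENNReal.tsum_mul_left]
        _ ≤ ∑' t, ∑' v, wt (natCost t) * wt t *
            (2 * ∑' _ : {w // IsExtension U I J t v w}, 1) := by
            refine ENNReal.tsum_le_tsum fun t => ENNReal.tsum_le_tsum fun v => ?_
            gcongr
            exact tsum_ite_two_pow_le _
        _ ≤ _ := by
            refine ENNReal.tsum_le_tsum fun t => ?_
            simp only [ENNReal.tsum_mul_left]
            calc _ ≤ wt (natCost t) * wt t * (2 * 2 ^ t) := by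
                  gcongr
                  exact tsum_isExtension_le hU h t
              _ = wt (natCost t) * (2 ^ t * wt t) * 2 := by ring
              _ = _ := by rw [two_pow_mul_wt, mul_one])
  refine ⟨c, fun t n v hn => ?_⟩
  obtain ⟨hfin, hcard⟩ := finite_isExtension hU I J t v
  have hnt : n ≤ t := (Nat.pow_le_pow_iff_right (a := 2) (by norm_num)).1 (hn.trans hcard)
  rw [Set.ncard_eq_toFinset_card _ hfin] at hn
  obtain ⟨s, hs, hscard⟩ := Finset.exists_subset_card_eq hn
  have := hc [] ((t, v), n) ⟨s.toList, s.nodup_toList, by simpa using hscard, fun w hw => by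
    simpa using hs (Finset.mem_toList.1 hw)⟩
  simp only at this
  rw [K]
  omega

/-- Symmetry of information. -/
theorem exists_condK_sub_add_le (hU : IsOptimalPrefixMachine U) {I J : Finset (Fin m)}
    (h : J ⊆ I) : ∃ c, ∀ x : Fin m → List Bool,
      condK U (sub x I) (sub x J) + K U (sub x J)
        ≤ K U (sub x I) + 3 * natCost (K U (sub x I)) + c := by
  obtain ⟨c₁, hc₁⟩ := exists_condK_add_log_le hU h
  obtain ⟨c₂, hc₂⟩ := exists_condK_le_of_ncard_le hU (Q := ℕ)
    (S := fun z w => IsExtension U I J z.2 z.1 w)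
    (semiDecidable_isExtension hU I J (Primrec.snd.comp Primrec.fst)
      (Primrec.fst.comp Primrec.fst) Primrec.snd) primrec_natCost tsum_wt_natCost_ne_top
  refine ⟨c₁ + c₂ + 1, fun x => ?_⟩
  set t := K U (sub x I) with ht
  obtain ⟨hfin, hcard⟩ := finite_isExtension hU I J t (sub x J)
  have hx : IsExtension U I J t (sub x J) (sub x I) := ⟨le_rfl, x, rfl, rfl⟩
  set N := {w | IsExtension U I J t (sub x J) w}.ncard with hN
  have hpos : 0 < N := (Set.ncard_pos hfin).2 ⟨_, hx⟩
  have hlog : Nat.clog 2 N ≤ t := (Nat.clog_le_iff_le_pow (by norm_num)).2 hcard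
  -- Given x_J, the string x_I is found by its rank among the N extensions, at the cost of log N
  -- bits. Conversely these N extensions make x_J simple by log N bits, so log N cancels. The three
  -- `natCost` terms pay for t in both descriptions and for the length of the rank.
  have h1 := hc₂ (sub x J) t (sub x I) (Nat.clog 2 N) hx hfin (Nat.le_pow_clog (by norm_num) _)
  -- The rounded-up logarithm minus 1 is a lower bound for log N; for N = 1 truncation gives 0.
  have h2 := hc₁ t (Nat.clog 2 N - 1) (sub x J) (by
    rcases Nat.lt_or_ge 1 N with h' | h'
    · exact (Nat.pow_pred_clog_lt_self (by norm_num) h').le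
    · have : N = 1 := by omega
      simp [← hN, this])
  have h3 := natCost_mono hlog
  omega

end Symmetry

/-- The conditional complexity `K(x_I|x_J)` in terms of unconditional complexities. -/
theorem exists_condK_sub_bounds {U : List Bool → List Bool →. List Bool}
    (hU : IsOptimalPrefixMachine U) {m : ℕ} (I J : Finset (Fin m)) :
    ∃ c, ∀ x : Fin m → List Bool,
      K U (sub x (I ∪ J)) ≤ K U (sub x J) + condK U (sub x I) (sub x J) + c ∧
      condK U (sub x I) (sub x J) + K U (sub x J)
        ≤ K U (sub x (I ∪ J)) + 3 * natCost (K U (sub x (I ∪ J))) + c := by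
  obtain ⟨c₁, hc₁⟩ := exists_condK_sub_union_le hU I J
  obtain ⟨c₂, hc₂⟩ := exists_condK_sub_self_le hU I J
  obtain ⟨c₃, hc₃⟩ := exists_condK_sub_add_le hU (Finset.subset_union_right (s₁ := I) (s₂ := J))
  refine ⟨c₁ + c₂ + c₃, fun x => ?_⟩
  have h1 := hc₁ x []
  have h2 := hc₂ x
  have h3 := hc₃ x
  simp only [K] at *
  omega

/-! ### Profile classes -/

theorem tsum_wt_sum_natCost_ne_top (d : ℕ) :
    ∑' k : Fin d → ℕ, wt (∑ i, natCost (k i)) ≠ ⊤ := by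
  induction d with
  | zero => simp [wt]
  | succ d ih =>
    rw [← (Fin.consEquiv fun _ : Fin (d + 1) => ℕ).tsum_eq,
      ENNReal.tsum_prod (f := fun a (k : Fin d → ℕ) => wt (∑ i, natCost
        ((Fin.consEquiv fun _ : Fin (d + 1) => ℕ) (a, k) i)))]
    simp only [Fin.consEquiv_apply, Fin.sum_univ_succ, Fin.cons_zero, Fin.cons_succ, wt_add,
      ENNReal.tsum_mul_left, ENNReal.tsum_mul_right]
    exact ENNReal.mul_ne_top tsum_wt_natCost_ne_top ih

theorem primrec_finset_sum {α ι : Type*} [Primcodable α] (s : Finset ι) {f : ι → α → ℕ}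
    (hf : ∀ i, Primrec (f i)) : Primrec fun a => ∑ i ∈ s, f i a := by
  classical
  induction s using Finset.induction_on with
  | empty => exact Primrec.const 0
  | insert i s hi ih =>
    simp only [Finset.sum_insert hi]
    exact Primrec.nat_add.comp (hf i) ih

section Profile

variable {U : List Bool → List Bool →. List Bool} {m : ℕ}

/-- The tuples whose complexities for the index sets in `F` are bounded by the profile `k`. -/
def profileClass (U : List Bool → List Bool →. List Bool) (F : Finset (Finset (Fin m))) (c : ℕ)
    (k : Finset (Fin m) → ℕ) : Set (Fin m → List Bool) :=
  {z | ∀ J ∈ F, K U (sub z J) ≤ k J ∧ condK U (sub z Finset.univ) (sub z J) + k J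
    ≤ k Finset.univ + 3 * natCost (k Finset.univ) + c}

/-- Only the values on F matter, so |F| numbers suffice to enumerate the class. -/
theorem profileClass_congr {F : Finset (Finset (Fin m))} (hF : Finset.univ ∈ F) (c : ℕ)
    {k k' : Finset (Fin m) → ℕ} (h : ∀ J ∈ F, k J = k' J) :
    profileClass U F c k = profileClass U F c k' := by
  ext z
  refine forall₂_congr fun J hJ => ?_
  rw [h J hJ, h _ hF]

theorem finite_profileClass (hU : IsOptimalPrefixMachine U) {F : Finset (Finset (Fin m))}
    (hF : Finset.univ ∈ F) (c : ℕ) (k : Finset (Fin m) → ℕ) : (profileClass U F c k).Finite ∧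
      (profileClass U F c k).ncard ≤ 2 ^ k Finset.univ := by
  obtain ⟨h1, h2⟩ := finite_condK_le hU [] (k Finset.univ)
  have hmaps : ∀ z ∈ profileClass U F c k,
      sub z Finset.univ ∈ {w | condK U w [] ≤ k Finset.univ} := fun z hz => (hz _ hF).1
  exact ⟨Set.Finite.of_injOn hmaps sub_univ_injective.injOn h1,
    (Set.ncard_le_ncard_of_injOn _ hmaps sub_univ_injective.injOn h1).trans h2⟩

theorem semiDecidable_profileClass (hU : IsOptimalPrefixMachine U)
    (F : Finset (Finset (Fin m))) (c : ℕ) {α : Type*} [Primcodable α]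
    {k : α → Finset (Fin m) → ℕ} (hk : ∀ J, Primrec fun a => k a J)
    {z : α → Fin m → List Bool} (hz : Primrec z) :
    SemiDecidable fun a => z a ∈ profileClass U F c (k a) := by
  refine SemiDecidable.forall_mem_finset F fun J _ =>
    .and (.condK_le hU ((primrec_sub J).comp hz) (Primrec.const []) (hk J)) ?_
  have hH : Primrec fun a => k a Finset.univ + 3 * natCost (k a Finset.univ) + c :=
    Primrec.nat_add.comp (Primrec.nat_add.comp (hk _) (Primrec.nat_mul.comp (Primrec.const 3)
      (primrec_natCost.comp (hk _)))) (Primrec.const c)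
  -- Moving k_J to the right-hand side uses truncated subtraction, hence the separate condition that
  -- it does not exceed the bound.
  refine ((SemiDecidable.condK_le hU ((primrec_sub Finset.univ).comp hz)
    ((primrec_sub J).comp hz) (Primrec.nat_sub.comp hH (hk J))).and
    (.of_primrecPred (PrimrecRel.comp Primrec.nat_le (hk J) hH))).of_eq fun a => ?_
  omega

/-- A lower bound on the number of tuples in a profile class. -/
theorem exists_K_sub_le_of_mem_profileClass (hU : IsOptimalPrefixMachine U)
    {F : Finset (Finset (Fin m))} (hF : Finset.univ ∈ F) (c₀ : ℕ) :
    ∃ c, ∀ k, ∀ z ∈ profileClass U F c₀ k, ∀ n, (profileClass U F c₀ k).ncard ≤ 2 ^ n →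
      K U (sub z Finset.univ) ≤ n + natCost n + ∑ J ∈ F, natCost (k J) + c := by
  classical
  let σ : F ≃ Fin F.card := F.equivFin
  let e : (Fin F.card → ℕ) → Finset (Fin m) → ℕ := fun κ J =>
    if h : J ∈ F then κ (σ ⟨J, h⟩) else 0
  have he : ∀ J, Primrec fun κ => e κ J := fun J => by
    by_cases h : J ∈ F
    · simp only [e, dif_pos h]
      exact Primrec.fin_app.comp Primrec.id (Primrec.const _)
    · simp only [e, dif_neg h]
      exact Primrec.const 0
  -- The class is indexed by the profile values on F, each paid for separately; this is the origin
  -- of the factor |F| in the error.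
  obtain ⟨c, hc⟩ := exists_condK_le_of_ncard_le hU (Q := Fin F.card → ℕ)
    (S := fun a w => ∃ z : Fin m → List Bool, w = sub z Finset.univ ∧
      z ∈ profileClass U F c₀ (e a.2))
    (SemiDecidable.exists_of (.and (.of_primrecPred (PrimrecRel.comp Primrec.eq
      (Primrec.snd.comp Primrec.fst) ((primrec_sub _).comp Primrec.snd)))
      (semiDecidable_profileClass hU F c₀ (fun J => (he J).comp
        (Primrec.snd.comp (Primrec.fst.comp Primrec.fst))) Primrec.snd)))
    (r := fun κ => ∑ i, natCost (κ i))
    (primrec_finset_sum _ fun i => primrec_natCost.comp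
      (Primrec.fin_app.comp Primrec.id (Primrec.const i)))
    (tsum_wt_sum_natCost_ne_top _)
  refine ⟨c, fun k z hz n hn => ?_⟩
  set κ : Fin F.card → ℕ := fun i => k (σ.symm i) with hκ
  have hk : profileClass U F c₀ k = profileClass U F c₀ (e κ) :=
    profileClass_congr hF c₀ fun J hJ => by simp [e, hκ, hJ]
  have hset : {w | ∃ z : Fin m → List Bool, w = sub z Finset.univ ∧
      z ∈ profileClass U F c₀ (e κ)} = (fun z => sub z Finset.univ) '' profileClass U F c₀ k := by
    rw [hk]
    ext w
    exact exists_congr fun z => by rw [and_comm, eq_comm]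
  have h := hc [] κ (sub z Finset.univ) n ⟨z, rfl, hk ▸ hz⟩
  simp only [hset] at h
  have h' := h ((finite_profileClass hU hF c₀ k).1.image _)
    ((Set.ncard_image_of_injective _ sub_univ_injective).trans_le hn)
  have hsum : ∑ i, natCost (κ i) = ∑ J ∈ F, natCost (k J) := by
    rw [← Finset.sum_coe_sort F, ← σ.symm.sum_comp]
  rw [hsum] at h'
  exact h'

end Profile

/-! ### Extracting a subset with large fibres -/

/-- A finite set with few fibers has a nonempty subset in which all fibers are large. -/
theorem exists_subset_large_fibers {α β ι : Type*} [DecidableEq β] (A : Finset α) (F : Finset ι)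
    (π : ι → α → β) (t : ι → ℝ)
    (hA : ∑ J ∈ F, t J * ((A.image (π J)).card : ℝ) < A.card) (ht : ∀ J ∈ F, 0 ≤ t J) :
    ∃ A' ⊆ A, A'.Nonempty ∧ ∀ J ∈ F, ∀ a ∈ A', t J ≤ ((A'.filter (π J · = π J a)).card : ℝ) := by
  classical
  -- Maximize this potential. It is positive on A and zero on the empty set, so a maximizer is
  -- nonempty. Deleting a whole fibre over J lowers the image by at least one point and so gains at
  -- least t_J; by maximality the fibre has at least t_J elements.
  let φ : Finset α → ℝ := fun B => B.card - ∑ J ∈ F, t J * ((B.image (π J)).card : ℝ)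
  obtain ⟨A', hA', hmax⟩ := Finset.exists_max_image A.powerset φ ⟨A, by simp⟩
  have hsub := Finset.mem_powerset.1 hA'
  refine ⟨A', hsub, ?_, fun J hJ a ha => ?_⟩
  · by_contra hne
    rw [Finset.not_nonempty_iff_eq_empty] at hne
    have := hmax A (by simp)
    simp only [φ, hne, Finset.card_empty, Finset.image_empty, Nat.cast_zero, mul_zero,
      Finset.sum_const_zero] at this
    linarith
  · set B := A'.filter fun b => ¬ π J b = π J a with hB
    have hmaxB := hmax B (Finset.mem_powerset.2 ((Finset.filter_subset _ _).trans hsub))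
    have hcard : ((A'.filter (π J · = π J a)).card : ℝ) + B.card = A'.card := by
      exact_mod_cast Finset.card_filter_add_card_filter_not _
    have himage : ∀ I, (B.image (π I)).card ≤ (A'.image (π I)).card := fun I =>
      Finset.card_le_card (Finset.image_subset_image (Finset.filter_subset _ _))
    have himageJ : (B.image (π J)).card + 1 ≤ (A'.image (π J)).card := by
      rw [Nat.add_one_le_iff]
      refine Finset.card_lt_card (Finset.ssubset_iff_subset_ne.2
        ⟨Finset.image_subset_image (Finset.filter_subset _ _), fun heq => ?_⟩)
      have : π J a ∈ B.image (π J) := heq ▸ Finset.mem_image_of_mem _ ha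
      obtain ⟨b, hb, hba⟩ := Finset.mem_image.1 this
      exact (Finset.mem_filter.1 hb).2 hba
    have hsum : ∑ I ∈ F, t I * ((B.image (π I)).card : ℝ) + t J
        ≤ ∑ I ∈ F, t I * ((A'.image (π I)).card : ℝ) := by
      rw [← Finset.add_sum_erase _ _ hJ, ← Finset.add_sum_erase _ _ hJ]
      have h1 : ∑ I ∈ F.erase J, t I * ((B.image (π I)).card : ℝ)
          ≤ ∑ I ∈ F.erase J, t I * ((A'.image (π I)).card : ℝ) :=
        Finset.sum_le_sum fun I hI => mul_le_mul_of_nonneg_left (by exact_mod_cast himage I)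
          (ht I (Finset.mem_of_mem_erase hI))
      have h2 : t J * (((B.image (π J)).card : ℝ) + 1) ≤ t J * ((A'.image (π J)).card : ℝ) :=
        mul_le_mul_of_nonneg_left (by exact_mod_cast himageJ) (ht J hJ)
      linarith
    simp only [φ] at hmaxB
    linarith

/-! ### Uniform distributions and uniform constants -/

theorem sameOutcome_inter {Ω : Type*} {m : ℕ} (Z : Fin m → Ω → List Bool) (I J : Finset (Fin m)) (ω : Ω) :
    sameOutcome Z J ω ∩ sameOutcome Z I ω = sameOutcome Z (I ∪ J) ω := by
  ext ω'
  simp only [sameOutcome, Set.mem_inter_iff, Set.mem_ofPred_eq, Finset.mem_union]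
  constructor
  · rintro ⟨h1, h2⟩ i (hi | hi)
    exacts [h2 i hi, h1 i hi]
  · exact fun h => ⟨fun i hi => h i (.inr hi), fun i hi => h i (.inl hi)⟩

theorem condProb_uniformOn_univ {Ω : Type*} [Fintype Ω] {m : ℕ} [MeasurableSpace Ω]
    [MeasurableSingletonClass Ω] [Nonempty Ω] (Z : Fin m → Ω → List Bool) (I J : Finset (Fin m)) (ω : Ω) :
    condProb (ProbabilityTheory.uniformOn Set.univ) Z I J ω
      = ((sameOutcome Z (I ∪ J) ω).ncard : ℝ) / (sameOutcome Z J ω).ncard := by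
  have hcount : ∀ s : Set Ω, (ProbabilityTheory.uniformOn Set.univ s).toReal
      = (s.ncard : ℝ) / Fintype.card Ω := fun s => by
    rw [ProbabilityTheory.uniformOn_univ, ENNReal.toReal_div,
      Measure.count_apply_finite' s.toFinite s.toFinite.measurableSet,
      Set.ncard_eq_toFinset_card s s.toFinite]
    simp
  have hΩ : (Fintype.card Ω : ℝ) ≠ 0 := by exact_mod_cast Fintype.card_ne_zero
  rw [condProb, ProbabilityTheory.cond_apply (Set.toFinite _).measurableSet, sameOutcome_inter,
    ENNReal.toReal_mul, ENNReal.toReal_inv, hcount, hcount]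
  field_simp

theorem exists_uniform_bound {ι : Type*} [Finite ι] {p : ι → ℕ → Prop}
    (hp : ∀ i c c', c ≤ c' → p i c → p i c') (h : ∀ i, ∃ c, p i c) : ∃ c, ∀ i, p i c := by
  cases nonempty_fintype ι
  choose c hc using h
  exact ⟨∑ i, c i, fun i => hp i _ _
    (Finset.single_le_sum (fun _ _ => Nat.zero_le _) (Finset.mem_univ i)) (hc i)⟩

theorem logb_natCast_nonneg (n : ℕ) : 0 ≤ Real.logb 2 n := by
  rw [Real.logb]
  exact div_nonneg (Real.log_natCast_nonneg n) (Real.log_nonneg (by norm_num))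

/-- All numbers that enter the descriptions are at most s + O(1), so each costs at most 17/16 · log
s + O(1). -/
theorem exists_natCost_le (c : ℕ) :
    ∃ C : ℝ, 0 ≤ C ∧ ∀ s t : ℕ, t ≤ s + c → (natCost t : ℝ) ≤ 17 / 16 * Real.logb 2 s + C := by
  have hC : 0 ≤ Real.logb 2 ((c + 2 : ℕ) : ℝ) := logb_natCast_nonneg _
  refine ⟨17 / 16 * Real.logb 2 ((c + 2 : ℕ) : ℝ), by positivity, fun s t h => ?_⟩
  refine (natCost_le t).trans ?_
  rw [← mul_add]
  refine mul_le_mul_of_nonneg_left ?_ (by norm_num)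
  -- For s = 0 the convention log 0 = 0 applies, and t ≤ c makes the cost a constant.
  rcases Nat.eq_zero_or_pos s with rfl | hs
  · simp only [CharP.cast_eq_zero, Real.logb_zero, zero_add]
    refine Real.logb_le_logb_of_le (by norm_num) (by positivity) ?_
    exact_mod_cast (by omega : t + 1 ≤ c + 2)
  · rw [← Real.logb_mul (by positivity) (by positivity)]
    refine Real.logb_le_logb_of_le (by norm_num) (by positivity) ?_
    have : t + 1 ≤ s * (c + 2) := by nlinarith
    exact_mod_cast this

/-! ### Construction of the random variables -/

section Main

variable {U : List Bool → List Bool →. List Bool} {m : ℕ}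

theorem exists_condK_self_le (hU : IsOptimalPrefixMachine U) : ∃ c, ∀ y, condK U y y ≤ c := by
  obtain ⟨c, hc⟩ := exists_condK_le hU (Q := List Bool) (R := fun y q => q = y)
    (.of_primrecPred (PrimrecRel.comp Primrec.eq Primrec.snd Primrec.fst))
    (r := fun _ => 0) (Primrec.const 0) (o := fun q => q) Primrec.id (B := 1) (by simp) fun y => by
      simp [wt]
  exact ⟨c, fun y => by simpa using hc y y rfl⟩

theorem exists_condK_sub_univ_le (hU : IsOptimalPrefixMachine U) (m : ℕ) :
    ∃ c, ∀ (I : Finset (Fin m)) (x : Fin m → List Bool),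
      condK U (sub x I) (sub x Finset.univ) ≤ c := by
  refine exists_uniform_bound (fun I c c' h hc x => (hc x).trans h) fun I => ?_
  obtain ⟨c, hc⟩ := exists_condK_sub_le_of_subset hU (Finset.subset_univ I)
  obtain ⟨c', hc'⟩ := exists_condK_self_le hU
  exact ⟨c' + c, fun x => (hc x _).trans (Nat.add_le_add_right (hc' _) c)⟩

theorem exists_K_sub_le (hU : IsOptimalPrefixMachine U) (m : ℕ) :
    ∃ c, ∀ (I : Finset (Fin m)) (x : Fin m → List Bool),
      K U (sub x I) ≤ K U (sub x Finset.univ) + c := by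
  refine exists_uniform_bound (fun I c c' h hc x => (hc x).trans (by omega)) fun I => ?_
  obtain ⟨c, hc⟩ := exists_condK_sub_le_of_subset hU (Finset.subset_univ I)
  exact ⟨c, fun x => hc x []⟩

theorem exists_condK_sub_bounds_uniform (hU : IsOptimalPrefixMachine U) (m : ℕ) :
    ∃ c, ∀ (P : Finset (Fin m) × Finset (Fin m)) (x : Fin m → List Bool),
      K U (sub x (P.1 ∪ P.2)) ≤ K U (sub x P.2) + condK U (sub x P.1) (sub x P.2) + c ∧
      condK U (sub x P.1) (sub x P.2) + K U (sub x P.2)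
        ≤ K U (sub x (P.1 ∪ P.2)) + 3 * natCost (K U (sub x (P.1 ∪ P.2))) + c :=
  exists_uniform_bound (fun P c c' h hc x => ⟨(hc x).1.trans (by omega),
    (hc x).2.trans (by omega)⟩) fun P => exists_condK_sub_bounds hU P.1 P.2

/-- For every tuple there is a finite set of tuples whose fibers have sizes that are given by the
complexities of the tuple. -/
theorem exists_finset_regular_fibers (hU : IsOptimalPrefixMachine U)
    {F : Finset (Finset (Fin m))} (hF : Finset.univ ∈ F) :
    ∃ c : ℝ, ∀ x : Fin m → List Bool, ∃ A : Finset (Fin m → List Bool), A.Nonempty ∧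
      ∀ J ∈ F, ∀ z ∈ A,
        (K U (sub x Finset.univ) : ℝ) - K U (sub x J)
          - (F.card + 1) * (17 / 16 * Real.logb 2 (K U (sub x Finset.univ))) - c
          ≤ Real.logb 2 ((A.filter (sub · J = sub z J)).card) ∧
        Real.logb 2 ((A.filter (sub · J = sub z J)).card)
          ≤ K U (sub x Finset.univ) - K U (sub x J)
            + 3 * (17 / 16 * Real.logb 2 (K U (sub x Finset.univ))) + c := by
  classical
  obtain ⟨c₀, hc₀⟩ := exists_condK_sub_bounds_uniform hU m
  obtain ⟨c₁, hc₁⟩ := exists_K_sub_le_of_mem_profileClass hU hF c₀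
  obtain ⟨c₂, hc₂⟩ := exists_K_sub_le hU m
  obtain ⟨C, hC0, hC⟩ := exists_natCost_le c₂
  have hd : 0 ≤ Real.logb 2 ((F.card + 1 : ℕ) : ℝ) := logb_natCast_nonneg _
  refine ⟨(F.card + 4) * C + c₀ + c₁ + 1 + Real.logb 2 ((F.card + 1 : ℕ) : ℝ), fun x => ?_⟩
  set k : Finset (Fin m) → ℕ := fun J => K U (sub x J) with hk
  set L := 17 / 16 * Real.logb 2 (K U (sub x Finset.univ)) with hL
  have hkc : ∀ J, (natCost (k J) : ℝ) ≤ L + C := fun J => hC _ _ (hc₂ J x)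
  have hbound : ∀ J, condK U (sub x Finset.univ) (sub x J) + k J
      ≤ k Finset.univ + 3 * natCost (k Finset.univ) + c₀ := fun J => by
    have h := (hc₀ (Finset.univ, J) x).2
    rwa [Finset.union_eq_left.2 (Finset.subset_univ J)] at h
  have hx : x ∈ profileClass U F c₀ k := fun J _ => ⟨le_rfl, hbound J⟩
  obtain ⟨hfin, hcard⟩ := finite_profileClass hU hF c₀ k
  set A := hfin.toFinset with hA
  have hAcard : (profileClass U F c₀ k).ncard = A.card := Set.ncard_eq_toFinset_card _ hfin
  rw [hAcard] at hcard
  have hApos : 0 < A.card := Finset.card_pos.2 ⟨x, by simpa [hA] using hx⟩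
  -- The class is large because x belongs to it: a small class would give x_M a description shorter
  -- than s. The |F| + 1 cost terms pay for the profile and for the length of the rank.
  have hAlog : (k Finset.univ : ℝ) - (F.card + 1) * (L + C) - c₁ - 1 ≤ Real.logb 2 A.card := by
    have hn : Nat.clog 2 A.card ≤ k Finset.univ := (Nat.clog_le_iff_le_pow (by norm_num)).2 hcard
    have h1 := hc₁ k x hx (Nat.clog 2 A.card) (hAcard ▸ Nat.le_pow_clog (by norm_num) _)
    have h2 : (K U (sub x Finset.univ) : ℝ) ≤ Nat.clog 2 A.card + natCost (Nat.clog 2 A.card)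
        + ∑ J ∈ F, (natCost (k J) : ℝ) + c₁ := by exact_mod_cast h1
    have h3 : ∑ J ∈ F, (natCost (k J) : ℝ) ≤ F.card * (L + C) := by
      rw [← nsmul_eq_mul]
      exact Finset.sum_le_card_nsmul _ _ _ fun J _ => hkc J
    have h4 : (natCost (Nat.clog 2 A.card) : ℝ) ≤ L + C := hC _ _ (hn.trans (by simp [hk]))
    have h5 : (Nat.clog 2 A.card : ℝ) - 1 ≤ Real.logb 2 A.card := by
      have h6 : Nat.clog 2 A.card ≤ Nat.log 2 A.card + 1 :=
        (Nat.clog_le_iff_le_pow (by norm_num)).2 (Nat.lt_pow_succ_log_self (by norm_num) _).le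
      have h7 := Real.natLog_le_logb A.card 2
      have h8 : (Nat.clog 2 A.card : ℝ) ≤ Nat.log 2 A.card + 1 := by exact_mod_cast h6
      push_cast at h7
      linarith
    have h9 : (k Finset.univ : ℝ) = K U (sub x Finset.univ) := rfl
    linarith
  have himage : ∀ J ∈ F, (A.image fun z => sub z J).card ≤ 2 ^ k J := fun J hJ => by
    obtain ⟨h1, h2⟩ := finite_condK_le hU [] (k J)
    refine le_trans (Finset.card_le_card (t := h1.toFinset) fun w hw => ?_)
      ((Set.ncard_eq_toFinset_card _ h1).symm.trans_le h2)
    obtain ⟨z, hz, rfl⟩ := Finset.mem_image.1 hw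
    have hz' : z ∈ profileClass U F c₀ k := by simpa [hA] using hz
    simpa [K] using (hz' J hJ).1
  -- The threshold for J is the average fibre size, with z_J having at most 2^(k_J) values, divided
  -- by |F| + 1. The extra 1 makes the total over F strictly smaller than |A|.
  obtain ⟨A', hA', hne, hlarge⟩ := exists_subset_large_fibers A F
    (fun J (z : Fin m → List Bool) => sub z J)
    (fun J => (A.card : ℝ) / (F.card + 1) / 2 ^ k J) (by
      calc _ ≤ ∑ J ∈ F, (A.card : ℝ) / (F.card + 1) := by
            refine Finset.sum_le_sum fun J hJ => ?_
            rw [div_mul_eq_mul_div, div_le_iff₀ (by positivity)]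
            gcongr
            exact_mod_cast himage J hJ
        _ = (A.card : ℝ) * (F.card / (F.card + 1)) := by
            rw [Finset.sum_const, nsmul_eq_mul]
            ring
        _ < A.card := by
            refine mul_lt_of_lt_one_right (by exact_mod_cast hApos) ?_
            rw [div_lt_one (by positivity)]
            linarith) (fun J _ => by positivity)
  refine ⟨A', hne, fun J hJ z hz => ?_⟩
  have hpos : 0 < (A'.filter (sub · J = sub z J)).card :=
    Finset.card_pos.2 ⟨z, by simp [hz]⟩
  have hposR : (0 : ℝ) < (A'.filter (sub · J = sub z J)).card := by exact_mod_cast hpos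
  have hkJ : (k J : ℝ) = K U (sub x J) := rfl
  have hkM : (k Finset.univ : ℝ) = K U (sub x Finset.univ) := rfl
  constructor
  · have h1 := Real.logb_le_logb_of_le (b := 2) (by norm_num) (by positivity) (hlarge J hJ z hz)
    have hAr : (A.card : ℝ) ≠ 0 := by exact_mod_cast hApos.ne'
    have h2 : Real.logb 2 ((A.card : ℝ) / (F.card + 1) / 2 ^ k J)
        = Real.logb 2 A.card - Real.logb 2 ((F.card + 1 : ℕ) : ℝ) - k J := by
      rw [Real.logb_div (by positivity) (by positivity),
        Real.logb_div hAr (by positivity), Real.logb_pow, Real.logb_self_eq_one (by norm_num)]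
      push_cast
      ring
    rw [h2] at h1
    refine le_trans ?_ h1
    have : (0 : ℝ) ≤ c₀ := by positivity
    rw [← hkJ, ← hkM]
    linarith
  -- All elements of a fibre have the same z_J and small complexity given it, so counting short
  -- programs bounds the fibre.
  · obtain ⟨h1, h2⟩ := finite_condK_le hU (sub z J)
      (k Finset.univ + 3 * natCost (k Finset.univ) + c₀ - k J)
    have h3 : (A'.filter (sub · J = sub z J)).card
        ≤ 2 ^ (k Finset.univ + 3 * natCost (k Finset.univ) + c₀ - k J) := by
      refine le_trans (Finset.card_le_card_of_injOn (t := h1.toFinset)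
        (fun z => sub z Finset.univ) (fun w hw => ?_) sub_univ_injective.injOn)
        ((Set.ncard_eq_toFinset_card _ h1).symm.trans_le h2)
      simp only [Finset.coe_filter, Set.mem_ofPred_eq] at hw
      have hw' : w ∈ profileClass U F c₀ k := by simpa [hA] using hA' hw.1
      have h4 := (hw' J hJ).2
      rw [hw.2] at h4
      simp only [Set.Finite.coe_toFinset, Set.mem_ofPred_eq]
      omega
    have h4 : Real.logb 2 ((A'.filter (sub · J = sub z J)).card)
        ≤ ((k Finset.univ + 3 * natCost (k Finset.univ) + c₀ - k J : ℕ) : ℝ) := by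
      rw [Real.logb_le_iff_le_rpow (by norm_num) hposR, Real.rpow_natCast]
      exact_mod_cast h3
    have h5 : k J ≤ k Finset.univ + 3 * natCost (k Finset.univ) + c₀ :=
      (Nat.le_add_left _ _).trans (hbound J)
    rw [Nat.cast_sub h5] at h4
    push_cast at h4
    have h6 := hkc Finset.univ
    have h7 : (0 : ℝ) ≤ (F.card + 1) * C := by positivity
    have h8 : (0 : ℝ) ≤ c₁ := by positivity
    rw [← hkJ, ← hkM]
    linarith

/-- The random variables of the theorem, for a fixed tuple and with an explicit error `E`. -/
def HasRandomization (U : List Bool → List Bool →. List Bool) (x : Fin m → List Bool)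
    (F : Finset (Finset (Fin m))) (E : ℝ) : Prop :=
  ∃ (Ω : Type) (_ : MeasurableSpace Ω) (P : Measure Ω) (Z : Fin m → Ω → List Bool),
    IsProbabilityMeasure P ∧ (∀ i : Fin m, Measurable[_, ⊤] (Z i)) ∧
    ∀ I J : Finset (Fin m), I ∪ J ∈ F → J ∈ F → ∀ ω : Ω, 0 < condProb P Z I J ω ∧
      |Real.logb 2 (condProb P Z I J ω) + (condK U (sub x I) (sub x J) : ℝ)| ≤ E

theorem hasRandomization_of_finset {x : Fin m → List Bool} {F : Finset (Finset (Fin m))} {E : ℝ}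
    {A : Finset (Fin m → List Bool)} (hA : A.Nonempty)
    (h : ∀ I J : Finset (Fin m), I ∪ J ∈ F → J ∈ F → ∀ z ∈ A,
      |Real.logb 2 ((A.filter (sub · (I ∪ J) = sub z (I ∪ J))).card)
        - Real.logb 2 ((A.filter (sub · J = sub z J)).card)
        + (condK U (sub x I) (sub x J) : ℝ)| ≤ E) : HasRandomization U x F E := by
  classical
  have : Nonempty A := hA.to_subtype
  let _ : MeasurableSpace A := ⊤
  have hcard : ∀ (J : Finset (Fin m)) (ω : A),
      (sameOutcome (fun i (z : A) => (z : Fin m → List Bool) i) J ω).ncard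
        = (A.filter (sub · J = sub (ω : Fin m → List Bool) J)).card := fun J ω => by
    rw [← Set.ncard_image_of_injective _ Subtype.val_injective, ← Set.ncard_coe_finset]
    congr 1
    ext z
    simp only [sameOutcome, Set.mem_image, Set.mem_ofPred_eq, Subtype.exists, exists_and_right,
      exists_eq_right, Finset.coe_filter, sub_eq_sub_iff]
    exact ⟨fun ⟨h1, h2⟩ => ⟨h1, h2⟩, fun ⟨h1, h2⟩ => ⟨h1, h2⟩⟩
  have hpos : ∀ (J : Finset (Fin m)) (ω : A),
      (0 : ℝ) < (A.filter (sub · J = sub (ω : Fin m → List Bool) J)).card := fun J ω => by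
    have : 0 < (A.filter (sub · J = sub (ω : Fin m → List Bool) J)).card :=
      Finset.card_pos.2 ⟨ω, by simp⟩
    exact_mod_cast this
  refine ⟨A, ⊤, ProbabilityTheory.uniformOn Set.univ, fun i z => (z : Fin m → List Bool) i,
    ProbabilityTheory.isProbabilityMeasure_uniformOn Set.finite_univ Set.univ_nonempty,
    fun i _ _ => MeasurableSpace.measurableSet_top, fun I J hIJ hJ ω => ?_⟩
  rw [condProb_uniformOn_univ, hcard, hcard,
    Real.logb_div (hpos _ _).ne' (hpos _ _).ne']
  exact ⟨div_pos (hpos _ _) (hpos _ _), h I J hIJ hJ ω ω.2⟩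

theorem exists_hasRandomization (hU : IsOptimalPrefixMachine U)
    {F : Finset (Finset (Fin m))} (hF : Finset.univ ∈ F) :
    ∃ c : ℝ, ∀ x : Fin m → List Bool, HasRandomization U x F
      ((2.2 * F.card + 5.5) * Real.logb 2 (K U (sub x Finset.univ)) + c) := by
  classical
  rcases Nat.lt_or_ge 1 F.card with hcard | hcard
  · obtain ⟨c₁, hc₁⟩ := exists_finset_regular_fibers hU hF
    obtain ⟨c₂, hc₂⟩ := exists_condK_sub_bounds_uniform hU m
    obtain ⟨c₃, hc₃⟩ := exists_K_sub_le hU m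
    obtain ⟨C, hC0, hC⟩ := exists_natCost_le c₃
    refine ⟨2 * c₁ + c₂ + 3 * C, fun x => ?_⟩
    obtain ⟨A, hA, hfib⟩ := hc₁ x
    refine hasRandomization_of_finset hA fun I J hIJ hJ z hz => ?_
    obtain ⟨l1, u1⟩ := hfib _ hIJ z hz
    obtain ⟨l2, u2⟩ := hfib _ hJ z hz
    obtain ⟨l3, u3⟩ := hc₂ (I, J) x
    have hcost := hC _ _ (hc₃ (I ∪ J) x)
    have l3' : (K U (sub x (I ∪ J)) : ℝ) ≤ K U (sub x J) + condK U (sub x I) (sub x J) + c₂ := by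
      exact_mod_cast l3
    have u3' : (condK U (sub x I) (sub x J) : ℝ) + K U (sub x J)
        ≤ K U (sub x (I ∪ J)) + 3 * natCost (K U (sub x (I ∪ J))) + c₂ := by
      exact_mod_cast u3
    have hL := logb_natCast_nonneg (K U (sub x Finset.univ))
    set L := Real.logb 2 (K U (sub x Finset.univ))
    have hd : (2 : ℝ) ≤ F.card := by exact_mod_cast hcard
    -- The 7 is 1 + 3 + 3: the surplus in the lower fibre bound, the upper fibre bound, and symmetry
    -- of information. The inequality of coefficients fails for |F| = 1, so that case is separate.
    have hslack : ((F.card : ℝ) + 7) * (17 / 16 * L) ≤ (2.2 * F.card + 5.5) * L := by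
      have : 0 ≤ (2.2 * (F.card : ℝ) + 5.5 - 17 / 16 * (F.card + 7)) * L :=
        mul_nonneg (by linarith) hL
      linarith
    rw [abs_le]
    constructor <;> linarith
  -- With F = {M} only conditioning on the whole tuple occurs. A constant random tuple works, as
  -- K(x_I|x_M) = O(1).
  · have hF1 : ∀ J ∈ F, J = Finset.univ := fun J hJ => Finset.card_le_one.1 hcard J hJ _ hF
    obtain ⟨c, hc⟩ := exists_condK_sub_univ_le hU m
    refine ⟨c, fun x => hasRandomization_of_finset (A := {x}) (by simp) fun I J hIJ hJ z hz => ?_⟩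
    obtain rfl := hF1 J hJ
    obtain rfl := Finset.mem_singleton.1 hz
    have h1 : ∀ J : Finset (Fin m),
        (({z} : Finset (Fin m → List Bool)).filter (sub · J = sub z J)).card = 1 := fun J => by
      simp [Finset.filter_singleton]
    rw [h1, h1, sub_self, zero_add, abs_of_nonneg (by positivity)]
    have h2 : (condK U (sub z I) (sub z Finset.univ) : ℝ) ≤ c := by exact_mod_cast hc I z
    have hL := logb_natCast_nonneg (K U (sub z Finset.univ))
    have : 0 ≤ (2.2 * (F.card : ℝ) + 5.5) * Real.logb 2 (K U (sub z Finset.univ)) := by positivity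
    linarith

theorem HasRandomization.mono {x : Fin m → List Bool} {F : Finset (Finset (Fin m))} {E E' : ℝ}
    (h : HasRandomization U x F E) (hE : E ≤ E') : HasRandomization U x F E' := by
  obtain ⟨Ω, i, P, Z, h1, h2, h3⟩ := h
  exact ⟨Ω, i, P, Z, h1, h2, fun I J hIJ hJ ω =>
    ⟨(h3 I J hIJ hJ ω).1, (h3 I J hIJ hJ ω).2.trans hE⟩⟩

/-- For fixed m there are finitely many families F, so the largest of their constants serves for
all; the term 2.2 K(F) ≥ 0 only enlarges the bound. -/
theorem exists_hasRandomization_errorBound (hU : IsOptimalPrefixMachine U) (m : ℕ) :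
    ∃ c : ℝ, ∀ (x : Fin m → List Bool) (F : Finset (Finset (Fin m))), Finset.univ ∈ F →
      HasRandomization U x F (errorBound U x F + c) := by
  have h : ∀ F : Finset (Finset (Fin m)), ∃ c : ℝ, Finset.univ ∈ F → ∀ x : Fin m → List Bool,
      HasRandomization U x F
        ((2.2 * F.card + 5.5) * Real.logb 2 (K U (sub x Finset.univ)) + c) := fun F => by
    by_cases hF : Finset.univ ∈ F
    · obtain ⟨c, hc⟩ := exists_hasRandomization hU hF
      exact ⟨c, fun _ => hc⟩
    · exact ⟨0, fun h => absurd h hF⟩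
  choose c hc using h
  obtain ⟨C, hC⟩ := Finite.exists_le c
  refine ⟨C, fun x F hF => (hc F hF x).mono ?_⟩
  have : (0 : ℝ) ≤ 2.2 * (K U (encodeFamily F) : ℝ) := by positivity
  have := hC F
  rw [errorBound]
  linarith

theorem prob_eq_condProb_empty {Ω : Type*} [MeasurableSpace Ω] (P : Measure Ω)
    [IsProbabilityMeasure P] (Z : Fin m → Ω → List Bool) (I : Finset (Fin m)) (ω : Ω) :
    prob P Z I ω = condProb P Z I ∅ ω := by
  have : sameOutcome Z ∅ ω = Set.univ := by simp [sameOutcome]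
  rw [prob, condProb, this, ProbabilityTheory.cond_univ]

end Main

end AlgInfo

theorem mainTheorem10
    (U : List Bool → List Bool →. List Bool) (hU : AlgInfo.IsOptimalPrefixMachine U) (m : ℕ) :
    ∃ c : ℝ, ∀ (x : Fin m → List Bool) (F : Finset (Finset (Fin m))), Finset.univ ∈ F →
      ∃ (Ω : Type) (_ : MeasurableSpace Ω) (P : MeasureTheory.Measure Ω)
        (Z : Fin m → Ω → List Bool),
        MeasureTheory.IsProbabilityMeasure P ∧
        (∀ i : Fin m, Measurable[_, ⊤] (Z i)) ∧
        (∀ I J : Finset (Fin m), I ∪ J ∈ F → J ∈ F →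
          (∀ ω : Ω, 0 < AlgInfo.condProb P Z I J ω ∧
            |Real.logb 2 (AlgInfo.condProb P Z I J ω)
                + (AlgInfo.condK U (AlgInfo.sub x I) (AlgInfo.sub x J) : ℝ)|
              ≤ AlgInfo.errorBound U x F + c) ∧
          (∀ ω ω' : Ω,
            |Real.logb 2 (AlgInfo.condProb P Z I J ω)
                - Real.logb 2 (AlgInfo.condProb P Z I J ω')|
              ≤ 2 * (AlgInfo.errorBound U x F + c))) ∧
        (∅ ∈ F → ∀ I ∈ F, ∀ ω : Ω, 0 < AlgInfo.prob P Z I ω ∧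
          |Real.logb 2 (AlgInfo.prob P Z I ω) + (AlgInfo.K U (AlgInfo.sub x I) : ℝ)|
            ≤ AlgInfo.errorBound U x F + c) := by
  obtain ⟨c, hc⟩ := AlgInfo.exists_hasRandomization_errorBound hU m
  refine ⟨c, fun x F hF => ?_⟩
  obtain ⟨Ω, mΩ, P, Z, hP, hZ, h⟩ := hc x F hF
  refine ⟨Ω, mΩ, P, Z, hP, hZ, fun I J hIJ hJ => ⟨h I J hIJ hJ, fun ω ω' => ?_⟩,
    fun hempty I hI ω => ?_⟩
  · have h1 := abs_le.1 (h I J hIJ hJ ω).2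
    have h2 := abs_le.1 (h I J hIJ hJ ω').2
    rw [abs_le]
    constructor <;> linarith
  · rw [AlgInfo.prob_eq_condProb_empty]
    have h1 := h I ∅ (by simpa using hI) hempty ω
    rwa [AlgInfo.sub_empty] at h1
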